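/- Let $N,d\ge 1$ be integers, $0<\varepsilon<1$, and let $\kappa,L_0,r_u>0$ and $M$ be real numbers. Put $\gamma=1-\frac{\varepsilon}{4N^2}$ and $\alpha=2+\frac{60N^2}{1-\gamma^2}$. There is a constant $C$, depending only on $N,d,\varepsilon,\kappa,L_0,r_u,M$, such that the following holds for every integer $T\ge 1$. Put $$\eta=\frac{1}{\sqrt{3\alpha}\,d\,L_0\,T^{2/3}},\qquad \delta=\frac{2}{T^{1/3}} .$$ *Network.* Let $\mathcal G$ be an undirected graph on the agents $\{1,\dots,N\}$ and let $A=[a_{ij}]$ be a doubly stochastic matrix (all row and column sums equal $1$) with $a_{ij}>\varepsilon$ if $i\ne j$ are adjacent, $a_{ij}=0$ if $i\neq j$ are not adjacent, and $a_{ii}\ge\kappa$ for all $i$. *Constraint set.* Let $\mathcal X\subset\mathbb R^d$ be closed and convex with $r_l\mathbb B\subseteq\mathcal X\subseteq r_u\mathbb B$ for some $r_l>0$, where $\mathbb B$ is the closed Euclidean unit ball. *Losses.* Let $f_t^i:\mathbb R^d\to\mathbb R$ ($-1\le t\le T$, $1\le i\le N$) be deterministic functions that are convex and $L_0$-Lipschitz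 on $\mathcal X+\delta\mathbb B$. Let $\mathcal X_\delta=\{x+\delta v: x\in\mathcal X,\ \|v\|=1\}$ and $$\theta_{i,t}=\sup_{z\in\mathcal X_\delta}|f_t^i(z)-f_{t-1}^i(z)|,\qquad \Theta_T=\sum_{t=1}^T\sum_{i=1}^N\theta_{i,t},$$ and suppose that $\theta_{i,0}\le M$ for all $i$. *Algorithm.* Let $x_{-1}^i,x_0^i\in\mathcal X$ be arbitrary deterministic initial points, let $u_t^i$ ($-1\le t\le T$, $1\le i\le N$) be independent random vectors uniformly distributed on the unit sphere of $\mathbb R^d$, and for $t=0,\dots,T$ let $$\widetilde g_t^i=\frac d\delta\Big(f_t^i(x_t^i+\delta u_t^i)-f_{t-1}^i(x_{t-1}^i+\delta u_{t-1}^i)\Big)u_t^i,\qquad x_{t+1}^i=\Pi_{\mathcal X}\Big[\sum_{j=1}^N a_{ij}\big(x_t^j-\eta\,\widetilde g_t^j\big)\Big],$$ where $\Pi_{\mathcal X}$ is the Euclidean projection onto $\mathcal X$. *Conclusion.* For every minimizer $x^*$ of $\sum_{t=1}^T\sum_{i=1}^N f_t^i$ over $\mathcal X$, the random variable $\sum_{t=1}^T\sum_{i=1}^N\big[f_t^i(x_t^i)-f_t^i(x^*)\big]$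 is integrable and the expected static regret satisfies $$R_g^T=\mathbb E\Big[\sum_{t=1}^T\sum_{i=1}^N\big[f_t^i(x_t^i)-f_t^i(x^*)\big]\Big]\le C\,\max\{T^{2/3},\Theta_T^2\}.$$ -/

import Mathlib

open MeasureTheory ProbabilityTheory

namespace DistORF

noncomputable section

/-- The decision space `ℝ^d` with its Euclidean norm. -/
abbrev Vec (d : ℕ) : Type := EuclideanSpace ℝ (Fin d)

/-- The uniform probability distribution on the unit sphere of `ℝ^d` (`d ≥ 1`): normalized
surface measure, viewed as a measure on `ℝ^d`. -/
def uniformSphere (d : ℕ) : Measure (Vec d) :=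
  (((volume : Measure (Vec d)).toSphere Set.univ)⁻¹ •
    (volume : Measure (Vec d)).toSphere).map Subtype.val

/-- Weights on an undirected graph on the agents: a nonnegative doubly stochastic matrix supported
on the edges and the diagonal, with weights larger than `ε` on the edges and diagonal weights at
least `κ`. -/
structure IsWeightMatrix {N : ℕ} (G : SimpleGraph (Fin N)) (A : Matrix (Fin N) (Fin N) ℝ)
    (ε κ : ℝ) : Prop where
  edge : ∀ i j, G.Adj j i → ε < A i j
  nonedge : ∀ i j, i ≠ j → ¬ G.Adj j i → A i j = 0
  diag : ∀ i, κ ≤ A i i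
  row_sum : ∀ i, ∑ j, A i j = 1
  col_sum : ∀ j, ∑ i, A i j = 1

/-- `γ = 1 - ε / (4 N ^ 2)`. -/
def mixRate (N : ℕ) (ε : ℝ) : ℝ := 1 - ε / (4 * (N : ℝ) ^ 2)

/-- `α = 2 + 60 N ^ 2 / (1 - γ ^ 2)`. -/
def alpha (N : ℕ) (ε : ℝ) : ℝ := 2 + 60 * (N : ℝ) ^ 2 / (1 - mixRate N ε ^ 2)

/-- The step size `η = 1 / (√(3 α) d L₀ T ^ (2/3))`. -/
def stepSize (N d : ℕ) (ε L₀ : ℝ) (T : ℕ) : ℝ :=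
  1 / (Real.sqrt (3 * alpha N ε) * d * L₀ * (T : ℝ) ^ (2 / 3 : ℝ))

/-- The exploration radius `δ = 2 / T ^ (1/3)`. -/
def radius (T : ℕ) : ℝ := 2 / (T : ℝ) ^ (1 / 3 : ℝ)

/-- The query region `X_δ = {x + δ v : x ∈ X, ‖v‖ = 1}`. -/
def queryRegion {d : ℕ} (X : Set (Vec d)) (δ : ℝ) : Set (Vec d) :=
  {z | ∃ x ∈ X, ∃ v : Vec d, ‖v‖ = 1 ∧ z = x + δ • v}

/-- The filled enlargement `{x + δ v : x ∈ X, ‖v‖ ≤ 1}` of `X`; it contains `X` and the query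
region, and is convex if `X` is. -/
def enlargement {d : ℕ} (X : Set (Vec d)) (δ : ℝ) : Set (Vec d) :=
  {z | ∃ x ∈ X, ∃ v : Vec d, ‖v‖ ≤ 1 ∧ z = x + δ • v}

/-- `θ_{i,t} = sup_{z ∈ X_δ} |f_t^i(z) - f_{t-1}^i(z)|`. -/
def theta {N d : ℕ} (X : Set (Vec d)) (δ : ℝ) (f : ℤ → Fin N → Vec d → ℝ) (t : ℤ) (i : Fin N) :
    ℝ :=
  sSup ((fun z => |f t i z - f (t - 1) i z|) '' queryRegion X δ)

/-- `Θ_T = ∑_{t=1}^T ∑_i θ_{i,t}`. -/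
def Theta {N d : ℕ} (X : Set (Vec d)) (δ : ℝ) (f : ℤ → Fin N → Vec d → ℝ) (T : ℕ) : ℝ :=
  ∑ t ∈ Finset.Icc (1 : ℤ) T, ∑ i, theta X δ f t i

/-- The one-point residual-feedback estimator
`(d / δ) (f_t^i(x_t^i + δ u_t^i) - f_{t-1}^i(x_{t-1}^i + δ u_{t-1}^i)) u_t^i`. -/
def orfEstimator {N d : ℕ} (δ : ℝ) (f : ℤ → Fin N → Vec d → ℝ) (u x : ℤ → Fin N → Vec d)
    (t : ℤ) (i : Fin N) : Vec d :=
  ((d : ℝ) / δ * (f t i (x t i + δ • u t i) - f (t - 1) i (x (t - 1) i + δ • u (t - 1) i))) •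
    u t i

/-- `p` is a Euclidean projection of `y` onto `X` (a nearest point of `X`; it exists and is unique
when `X` is nonempty, closed and convex). -/
def IsProj {d : ℕ} (X : Set (Vec d)) (y p : Vec d) : Prop :=
  p ∈ X ∧ ∀ z ∈ X, ‖y - p‖ ≤ ‖y - z‖

/-- One sample path of the algorithm, for the rounds `t = 0, …, T`:
`x_{t+1}^i = Π_X [∑_j a_{ij} (x_t^j - η g_t^j)]`, with `g_t^j` the residual-feedback estimator. The
initial data are `x_0^i` and the point `x_{-1}^i` to which the first residual refers. -/
structure IsRun {N d : ℕ} (X : Set (Vec d)) (A : Matrix (Fin N) (Fin N) ℝ) (η δ : ℝ)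
    (f : ℤ → Fin N → Vec d → ℝ) (T : ℕ) (xprev xinit : Fin N → Vec d)
    (u x : ℤ → Fin N → Vec d) : Prop where
  start_prev : ∀ i, x (-1) i = xprev i
  start : ∀ i, x 0 i = xinit i
  step : ∀ t : ℤ, 0 ≤ t → t ≤ T → ∀ i,
    IsProj X (∑ j, A i j • (x t j - η • orfEstimator δ f u x t j)) (x (t + 1) i)

/-- The pathwise static regret `∑_{t=1}^T ∑_i (f_t^i(x_t^i) - f_t^i(x*))`. -/
def pathRegret {N d : ℕ} (f : ℤ → Fin N → Vec d → ℝ) (T : ℕ) (xstar : Vec d)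
    (x : ℤ → Fin N → Vec d) : ℝ :=
  ∑ t ∈ Finset.Icc (1 : ℤ) T, ∑ i, (f t i (x t i) - f t i xstar)

end

end DistORF

/-!
The averaging step is a convex combination with a doubly stochastic matrix and the projection is
nonexpansive, so the total squared distance of the agents to the comparator obeys the usual descent
inequality of projected gradient methods. Since the regret evaluates the losses of each agent at its
own iterate, no consensus between agents is needed for this part, and connectedness of the
graph plays no role.

The difficulty is the size of the residual-feedback estimators, which depends on how far the
iterates move. By the variance identity, averaging makes the squared distance to the comparator
drop by at least `κ` times the total squared displacement caused by averaging
(`sum_norm_average_sub_sq_add_le`). This dissipation bounds the distances travelled by the initial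
distance, the linearized regret and the estimators (`sum_norm_step_sub_sq_add_le`), and the
estimators are bounded by the distances travelled and the variation of the losses
(`norm_orfEstimator_sq_le`). Once `T ^ (2/3) ≥ 1 + 1/κ` this feedback loop is a contraction, and
the linearized regret is bounded on every sample path (`IsRun.sum_inner_orfEstimator_le`). Smaller
`T` are covered by the trivial bound `pathRegret_le`.

It remains to compare the linearized regret with the regret in expectation. Given the past, the
current direction is uniform on the sphere, so it suffices that the one-point estimator with any
baseline is an approximate subgradient of the loss on average (`sub_le_integral_estimator`). This
needs no divergence theorem: each direction is paired with its mirror image in the hyperplane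
orthogonal to `x - y`, which removes the baseline and reduces the claim to convexity on the line
through the two query points and the identity `∫ ⟪v, w⟫² = ‖w‖² / d` on the sphere.
-/

open MeasureTheory ProbabilityTheory

namespace DistORF

/-! ### Euclidean projections -/

theorem IsProj.inner_le_zero {d : ℕ} {X : Set (Vec d)} (hX : Convex ℝ X) {y p z : Vec d}
    (hp : IsProj X y p) (hz : z ∈ X) : inner ℝ (y - p) (z - p) ≤ 0 := by
  have hne : Nonempty X := ⟨⟨p, hp.1⟩⟩
  refine (norm_eq_iInf_iff_real_inner_le_zero hX hp.1).1 ?_ z hz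
  refine le_antisymm (le_ciInf fun w => hp.2 w w.2) ?_
  exact ciInf_le ⟨0, by rintro _ ⟨w, rfl⟩; exact norm_nonneg _⟩ (⟨p, hp.1⟩ : X)

theorem IsProj.norm_sub_le_norm_sub {d : ℕ} {X : Set (Vec d)} (hX : Convex ℝ X)
    {y y' p p' : Vec d} (hp : IsProj X y p) (hp' : IsProj X y' p') : ‖p - p'‖ ≤ ‖y - y'‖ := by
  have h1 := hp.inner_le_zero hX hp'.1
  have h2 := hp'.inner_le_zero hX hp.1
  have h3 : ‖p - p'‖ * ‖p - p'‖ ≤ inner ℝ (y - y') (p - p') := by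
    rw [← real_inner_self_eq_norm_mul_norm]
    simp only [inner_sub_left, inner_sub_right] at h1 h2 ⊢
    linarith [real_inner_comm p p']
  have h4 := real_inner_le_norm (y - y') (p - p')
  by_contra! h
  nlinarith [norm_nonneg (p - p'), norm_nonneg (y - y')]

theorem isProj_self {d : ℕ} {X : Set (Vec d)} {z : Vec d} (hz : z ∈ X) : IsProj X z z :=
  ⟨hz, fun w _ => by simp⟩

theorem exists_continuous_isProj {d : ℕ} {X : Set (Vec d)} (hc : IsClosed X) (hX : Convex ℝ X)
    (hne : X.Nonempty) : ∃ π : Vec d → Vec d, Continuous π ∧ ∀ y p, IsProj X y p ↔ p = π y := by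
  have hex : ∀ y : Vec d, ∃ p, IsProj X y p := by
    intro y
    obtain ⟨p, hp, h⟩ := exists_norm_eq_iInf_of_complete_convex hne hc.isComplete hX y
    refine ⟨p, hp, fun z hz => ?_⟩
    rw [h]
    exact ciInf_le ⟨0, by rintro _ ⟨w, rfl⟩; exact norm_nonneg _⟩ (⟨z, hz⟩ : X)
  choose π hπ using hex
  refine ⟨π, ?_, fun y p => ⟨fun h => ?_, fun h => h ▸ hπ y⟩⟩
  · refine (LipschitzWith.of_dist_le_mul (K := 1) fun y y' => ?_).continuous
    simpa [dist_eq_norm] using (hπ y).norm_sub_le_norm_sub hX (hπ y')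
  · have := h.norm_sub_le_norm_sub hX (hπ y)
    simpa [sub_eq_zero] using this

/-! ### Averaging with a doubly stochastic matrix -/

theorem IsWeightMatrix.nonneg {N : ℕ} {G : SimpleGraph (Fin N)} {A : Matrix (Fin N) (Fin N) ℝ}
    {ε κ : ℝ} (h : IsWeightMatrix G A ε κ) (hε : 0 ≤ ε) (hκ : 0 ≤ κ) (i j : Fin N) :
    0 ≤ A i j := by
  by_cases hij : i = j
  · subst hij
    exact hκ.trans (h.diag i)
  · by_cases hG : G.Adj j i
    · exact hε.trans (h.edge i j hG).le
    · exact (h.nonedge i j hij hG).ge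

/-- The variance decomposition for a convex combination. -/
theorem sum_mul_norm_sub_sq {ι E : Type*} [Fintype ι] [NormedAddCommGroup E]
    [InnerProductSpace ℝ E] (a : ι → ℝ) (ha : ∑ j, a j = 1) (y : ι → E) (z : E) :
    ∑ j, a j * ‖y j - z‖ ^ 2 =
      ‖∑ j, a j • y j - z‖ ^ 2 + ∑ j, a j * ‖y j - ∑ k, a k • y k‖ ^ 2 := by
  set m := ∑ k, a k • y k with hm
  have h0 : ∑ j, a j * inner ℝ (y j - m) (m - z) = 0 := by
    have : ∑ j, a j • (y j - m) = 0 := by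
      simp only [smul_sub, Finset.sum_sub_distrib, ← Finset.sum_smul, ha, one_smul, ← hm, sub_self]
    simp only [← real_inner_smul_left, ← sum_inner, this, inner_zero_left]
  have h1 : ∀ j, a j * ‖y j - z‖ ^ 2 =
      a j * ‖m - z‖ ^ 2 + a j * ‖y j - m‖ ^ 2 + 2 * (a j * inner ℝ (y j - m) (m - z)) := by
    intro j
    have : y j - z = (y j - m) + (m - z) := by abel
    rw [this, norm_add_sq_real]
    ring
  simp only [h1, Finset.sum_add_distrib, ← Finset.mul_sum, ← Finset.sum_mul, h0, ha]
  ring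

/-- Averaging decreases the total squared distance to any point, and the decrease controls how far
each agent moves: this dissipation replaces any mixing estimate for the network. -/
theorem sum_norm_average_sub_sq_add_le {N : ℕ} {E : Type*} [NormedAddCommGroup E]
    [InnerProductSpace ℝ E] {A : Matrix (Fin N) (Fin N) ℝ} {κ : ℝ} (hA : ∀ i j, 0 ≤ A i j)
    (hdiag : ∀ i, κ ≤ A i i) (hrow : ∀ i, ∑ j, A i j = 1) (hcol : ∀ j, ∑ i, A i j = 1)
    (y : Fin N → E) (z : E) :
    ∑ i, ‖∑ j, A i j • y j - z‖ ^ 2 + κ * ∑ i, ‖y i - ∑ j, A i j • y j‖ ^ 2 ≤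
      ∑ j, ‖y j - z‖ ^ 2 := by
  have h1 : ∀ i, ‖∑ j, A i j • y j - z‖ ^ 2 + κ * ‖y i - ∑ j, A i j • y j‖ ^ 2 ≤
      ∑ j, A i j * ‖y j - z‖ ^ 2 := by
    intro i
    rw [sum_mul_norm_sub_sq (A i) (hrow i) y z]
    have := Finset.single_le_sum (f := fun j => A i j * ‖y j - ∑ k, A i k • y k‖ ^ 2)
      (fun j _ => mul_nonneg (hA i j) (sq_nonneg _)) (Finset.mem_univ i)
    have h2 : κ * ‖y i - ∑ j, A i j • y j‖ ^ 2 ≤ A i i * ‖y i - ∑ j, A i j • y j‖ ^ 2 :=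
      mul_le_mul_of_nonneg_right (hdiag i) (sq_nonneg _)
    linarith
  calc _ = ∑ i, (‖∑ j, A i j • y j - z‖ ^ 2 + κ * ‖y i - ∑ j, A i j • y j‖ ^ 2) := by
        rw [Finset.sum_add_distrib, Finset.mul_sum]
    _ ≤ ∑ i, ∑ j, A i j * ‖y j - z‖ ^ 2 := Finset.sum_le_sum fun i _ => h1 i
    _ = ∑ j, ‖y j - z‖ ^ 2 := by
        rw [Finset.sum_comm]
        simp only [← Finset.sum_mul, hcol, one_mul]

/-! ### The uniform distribution on the sphere -/

theorem isProbabilityMeasure_uniformSphere {d : ℕ} (hd : 1 ≤ d) :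
    IsProbabilityMeasure (uniformSphere d) := by
  have : Nonempty (Fin d) := ⟨⟨0, hd⟩⟩
  have h0 : ((volume : Measure (Vec d)).toSphere Set.univ) ≠ 0 := by
    rw [Ne, Measure.measure_univ_eq_zero]
    exact Measure.toSphere_ne_zero _
  unfold uniformSphere
  refine @Measure.isProbabilityMeasure_map _ _ _ _ _ ⟨?_⟩ _ measurable_subtype_coe.aemeasurable
  simp only [Measure.smul_apply, smul_eq_mul]
  exact ENNReal.inv_mul_cancel h0 (measure_ne_top _ _)

theorem ae_norm_eq_one_uniformSphere (d : ℕ) : ∀ᵐ v ∂(uniformSphere d), ‖v‖ = 1 := by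
  unfold uniformSphere
  rw [ae_map_iff measurable_subtype_coe.aemeasurable
    (measurableSet_eq_fun measurable_norm measurable_const)]
  exact Filter.Eventually.of_forall fun v => by simp

theorem map_linearIsometryEquiv_uniformSphere {d : ℕ} (ρ : Vec d ≃ₗᵢ[ℝ] Vec d) :
    (uniformSphere d).map ρ = uniformSphere d := by
  have hval := (measurable_subtype_coe : Measurable
    (Subtype.val : Metric.sphere (0 : Vec d) 1 → Vec d))
  ext s hs
  have hs' := ρ.continuous.measurable hs
  rw [Measure.map_apply ρ.continuous.measurable hs]
  unfold uniformSphere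
  rw [Measure.map_apply hval hs, Measure.map_apply hval hs', Measure.smul_apply,
    Measure.smul_apply, Measure.toSphere_apply' _ (hval hs), Measure.toSphere_apply' _ (hval hs')]
  congr 2
  conv_rhs => rw [← ρ.measurePreserving.measure_preimage_equiv (f := ρ.toHomeomorph.toMeasurableEquiv)]
  congr 1
  ext v
  simp only [Set.mem_smul, Set.mem_image, Set.mem_preimage, Subtype.exists, mem_sphere_zero_iff_norm]
  constructor
  · rintro ⟨r, hr, _, ⟨u, hu, hus, rfl⟩, rfl⟩
    exact ⟨r, hr, ρ u, ⟨ρ u, by simpa using hu, hus, rfl⟩, by simp⟩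
  · rintro ⟨r, hr, _, ⟨u, hu, hus, rfl⟩, h⟩
    refine ⟨r, hr, ρ.symm u, ⟨ρ.symm u, by simpa using hu, by simpa using hus, rfl⟩, ?_⟩
    apply ρ.injective
    simpa using h

theorem integral_comp_linearIsometryEquiv_uniformSphere {d : ℕ} (ρ : Vec d ≃ₗᵢ[ℝ] Vec d)
    (h : Vec d → ℝ) : ∫ v, h (ρ v) ∂(uniformSphere d) = ∫ v, h v ∂(uniformSphere d) := by
  conv_rhs => rw [← map_linearIsometryEquiv_uniformSphere ρ]
  exact (integral_map_equiv ρ.toHomeomorph.toMeasurableEquiv h).symm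

theorem integrable_uniformSphere_of_continuous {d : ℕ} (hd : 1 ≤ d) {h : Vec d → ℝ}
    (hh : Continuous h) : Integrable h (uniformSphere d) := by
  have := isProbabilityMeasure_uniformSphere hd
  obtain ⟨C, hC⟩ := (isCompact_sphere (0 : Vec d) 1).exists_bound_of_continuousOn hh.continuousOn
  refine Integrable.of_bound hh.aestronglyMeasurable C ?_
  filter_upwards [ae_norm_eq_one_uniformSphere d] with v hv
  exact hC v (by simpa using hv)

theorem integral_inner_sq_uniformSphere {d : ℕ} (hd : 1 ≤ d) (w : Vec d) :
    ∫ v, (inner ℝ v w) ^ 2 ∂(uniformSphere d) = ‖w‖ ^ 2 / d := by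
  have := isProbabilityMeasure_uniformSphere hd
  have hd0 : (d : ℝ) ≠ 0 := by positivity
  have hi : ∀ z : Vec d, Integrable (fun v => (inner ℝ v z) ^ 2) (uniformSphere d) := fun z =>
    integrable_uniformSphere_of_continuous hd (by fun_prop)
  let e := EuclideanSpace.basisFun (Fin d) ℝ
  -- A reflection carries `w` to the multiple `‖w‖ • e i` of a basis vector.
  have h1 : ∀ i, ∫ v, (inner ℝ v w) ^ 2 ∂(uniformSphere d) =
      ∫ v, (inner ℝ v (‖w‖ • e i)) ^ 2 ∂(uniformSphere d) := by
    intro i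
    have hn : ‖w‖ = ‖‖w‖ • e i‖ := by simp [norm_smul]
    set ρ := (ℝ ∙ (w - ‖w‖ • e i))ᗮ.reflection
    have hρ : ρ w = ‖w‖ • e i := Submodule.reflection_sub hn
    rw [← integral_comp_linearIsometryEquiv_uniformSphere ρ
      (fun v => (inner ℝ v (‖w‖ • e i)) ^ 2), ← hρ]
    simp
  have h2 : (d : ℝ) * ∫ v, (inner ℝ v w) ^ 2 ∂(uniformSphere d) = ‖w‖ ^ 2 := by
    calc (d : ℝ) * ∫ v, (inner ℝ v w) ^ 2 ∂(uniformSphere d)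
        = ∑ i : Fin d, ∫ v, (inner ℝ v (‖w‖ • e i)) ^ 2 ∂(uniformSphere d) := by
          rw [← Finset.sum_congr rfl fun i _ => h1 i]
          simp
      _ = ∫ v, ∑ i : Fin d, (inner ℝ v (‖w‖ • e i)) ^ 2 ∂(uniformSphere d) :=
          (integral_finsetSum _ fun i _ => hi _).symm
      _ = ∫ v, ‖w‖ ^ 2 ∂(uniformSphere d) := by
          refine integral_congr_ae ?_
          filter_upwards [ae_norm_eq_one_uniformSphere d] with v hv
          have := e.sum_sq_norm_inner_left v
          simp only [Real.norm_eq_abs, sq_abs, hv, one_pow] at this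
          simp only [inner_smul_right, mul_pow, ← Finset.mul_sum, this, mul_one]
      _ = ‖w‖ ^ 2 := by simp
  field_simp
  linarith

/-! ### The one-point gradient estimate -/

theorem mem_enlargement_of_mem {d : ℕ} {X : Set (Vec d)} {x : Vec d} (δ : ℝ) (hx : x ∈ X) :
    x ∈ enlargement X δ := ⟨x, hx, 0, by simp, by simp⟩

theorem add_smul_mem_enlargement {d : ℕ} {X : Set (Vec d)} {x v : Vec d} (δ : ℝ) (hx : x ∈ X)
    (hv : ‖v‖ = 1) : x + δ • v ∈ enlargement X δ := ⟨x, hx, v, hv.le, rfl⟩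

theorem add_smul_mem_queryRegion {d : ℕ} {X : Set (Vec d)} {x v : Vec d} (δ : ℝ) (hx : x ∈ X)
    (hv : ‖v‖ = 1) : x + δ • v ∈ queryRegion X δ := ⟨x, hx, v, hv, rfl⟩

/-- Convexity along the line through `x + δ • v` and `x + δ • v'`, which is parallel to `x - y`:
the increment of `f` on a short segment is at least its proportional share of `f x - f y`, up to
the error made in replacing `x + δ • v'` and `y + δ • v'` by `x` and `y`. -/
theorem mul_sub_le_sub_of_convexOn {d : ℕ} {X : Set (Vec d)} {δ L s : ℝ} (hδ : 0 ≤ δ)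
    {f : Vec d → ℝ} (hf : ConvexOn ℝ (enlargement X δ) f)
    (hL : ∀ y ∈ enlargement X δ, ∀ z ∈ enlargement X δ, |f y - f z| ≤ L * ‖y - z‖)
    {x y v v' : Vec d} (hx : x ∈ X) (hy : y ∈ X) (hv : ‖v‖ = 1) (hv' : ‖v'‖ = 1) (hs : 0 ≤ s)
    (h : δ • v = δ • v' + s • (x - y)) :
    s * (f x - f y - 2 * L * δ) ≤ f (x + δ • v) - f (x + δ • v') := by
  have hX := add_smul_mem_enlargement δ hx hv
  have hX' := add_smul_mem_enlargement δ hx hv'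
  have hY' := add_smul_mem_enlargement δ hy hv'
  have h1 : (1 + s) * f (x + δ • v') ≤ s * f (y + δ • v') + f (x + δ • v) := by
    have hs1 : 0 < 1 + s := by linarith
    have := hf.2 hY' hX (show 0 ≤ s / (1 + s) by positivity)
      (show 0 ≤ 1 / (1 + s) by positivity) (by field_simp; ring)
    have he : (s / (1 + s)) • (y + δ • v') + (1 / (1 + s)) • (x + δ • v) = x + δ • v' := by
      have h2 : (1 + s) • ((s / (1 + s)) • (y + δ • v') + (1 / (1 + s)) • (x + δ • v)) =
          (1 + s) • (x + δ • v') := by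
        rw [smul_add, smul_smul, smul_smul, mul_div_cancel₀ _ hs1.ne', mul_div_cancel₀ _ hs1.ne', h]
        module
      exact smul_right_injective _ hs1.ne' h2
    rw [he, smul_eq_mul, smul_eq_mul] at this
    calc (1 + s) * f (x + δ • v') ≤ (1 + s) *
          (s / (1 + s) * f (y + δ • v') + 1 / (1 + s) * f (x + δ • v)) := by gcongr
      _ = s * f (y + δ • v') + f (x + δ • v) := by field_simp
  have hn : ‖δ • v'‖ = δ := by rw [norm_smul, hv', mul_one, Real.norm_of_nonneg hδ]
  have h3 := hL _ hX' _ (mem_enlargement_of_mem δ hx)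
  have h4 := hL _ hY' _ (mem_enlargement_of_mem δ hy)
  rw [add_sub_cancel_left, hn] at h3 h4
  have h5 : f x - f y - 2 * L * δ ≤ f (x + δ • v') - f (y + δ • v') := by
    linarith [(abs_le.1 h3).1, (abs_le.1 h4).2]
  nlinarith [mul_le_mul_of_nonneg_left h5 hs]

/-- The one-point estimator with an arbitrary baseline `b` is, in expectation, an approximate
subgradient. Each direction is paired with its mirror image in the hyperplane orthogonal to
`x - y`: the baseline cancels, and convexity applies along the direction `x - y`. -/
theorem sub_le_integral_estimator {d : ℕ} (hd : 1 ≤ d) {X : Set (Vec d)} {δ L : ℝ} (hδ : 0 < δ)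
    {f F : Vec d → ℝ} (hf : ConvexOn ℝ (enlargement X δ) f) (hL0 : 0 ≤ L)
    (hL : ∀ y ∈ enlargement X δ, ∀ z ∈ enlargement X δ, |f y - f z| ≤ L * ‖y - z‖)
    (hF : Continuous F) (hfF : Set.EqOn f F (enlargement X δ)) (b : ℝ)
    {x y : Vec d} (hx : x ∈ X) (hy : y ∈ X) :
    F x - F y - 2 * L * δ ≤
      ∫ v, inner ℝ (((d : ℝ) / δ * (F (x + δ • v) - b)) • v) (x - y) ∂(uniformSphere d) := by
  have := isProbabilityMeasure_uniformSphere hd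
  have hd0 : (0 : ℝ) < d := by positivity
  rcases eq_or_ne x y with rfl | hxy
  · simp
    positivity
  set w := x - y with hw
  have hw0 : 0 < ‖w‖ := norm_pos_iff.2 (sub_ne_zero.2 hxy)
  set ρ := (ℝ ∙ w)ᗮ.reflection with hρdef
  have hρ : ∀ v, ρ v = v - (2 * inner ℝ v w / ‖w‖ ^ 2) • w := by
    intro v
    rw [hρdef, Submodule.reflection_orthogonal_apply, Submodule.reflection_singleton_apply,
      real_inner_comm w v, neg_sub, ← Nat.cast_smul_eq_nsmul ℝ, smul_smul]
    congr 2
    simp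
    ring
  have hρw : ∀ v, inner ℝ (ρ v) w = - inner ℝ v w := by
    intro v
    rw [hρ, inner_sub_left, real_inner_smul_left, real_inner_self_eq_norm_sq]
    field_simp
    ring
  set J := fun v : Vec d => (F (x + δ • v) - b) * inner ℝ v w with hJ
  have hJi : Integrable J (uniformSphere d) :=
    integrable_uniformSphere_of_continuous hd (by fun_prop)
  have hJi' : Integrable (fun v => J (ρ v)) (uniformSphere d) :=
    integrable_uniformSphere_of_continuous hd (by have := ρ.continuous; fun_prop)
  have hpos : ∀ v : Vec d, ‖v‖ = 1 → 0 ≤ inner ℝ v w →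
      2 * δ * inner ℝ v w / ‖w‖ ^ 2 * (F x - F y - 2 * L * δ) ≤
        F (x + δ • v) - F (x + δ • ρ v) := by
    intro v hv hq
    have hv' : ‖ρ v‖ = 1 := by simpa using hv
    rw [← hfF (mem_enlargement_of_mem δ hx), ← hfF (mem_enlargement_of_mem δ hy),
      ← hfF (add_smul_mem_enlargement δ hx hv), ← hfF (add_smul_mem_enlargement δ hx hv')]
    refine mul_sub_le_sub_of_convexOn hδ.le hf hL hx hy hv hv' (by positivity) ?_
    rw [hρ, smul_sub, smul_smul, ← hw,
      show 2 * δ * inner ℝ v w / ‖w‖ ^ 2 = δ * (2 * inner ℝ v w / ‖w‖ ^ 2) by ring]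
    abel
  have hpt : ∀ v : Vec d, ‖v‖ = 1 →
      2 * δ / ‖w‖ ^ 2 * (F x - F y - 2 * L * δ) * (inner ℝ v w) ^ 2 ≤ J v + J (ρ v) := by
    intro v hv
    have hJv : J v + J (ρ v) = (F (x + δ • v) - F (x + δ • ρ v)) * inner ℝ v w := by
      simp only [hJ, hρw]
      ring
    rw [hJv]
    rcases le_total 0 (inner ℝ v w) with hq | hq
    · have := mul_le_mul_of_nonneg_right (hpos v hv hq) hq
      refine le_trans (le_of_eq ?_) this
      ring
    · have hρρ : ρ (ρ v) = v := Submodule.reflection_reflection _ v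
      have hq' : 0 ≤ inner ℝ (ρ v) w := by rw [hρw]; linarith
      have := mul_le_mul_of_nonneg_right (hpos (ρ v) (by simpa using hv) hq') hq'
      rw [hρρ, hρw] at this
      refine (le_of_eq ?_).trans (this.trans (le_of_eq ?_)) <;> ring
  have hint : 2 * δ / ‖w‖ ^ 2 * (F x - F y - 2 * L * δ) * (‖w‖ ^ 2 / d) ≤
      2 * ∫ v, J v ∂(uniformSphere d) := by
    calc _ = ∫ v, 2 * δ / ‖w‖ ^ 2 * (F x - F y - 2 * L * δ) * (inner ℝ v w) ^ 2
          ∂(uniformSphere d) := by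
          rw [integral_const_mul, integral_inner_sq_uniformSphere hd]
      _ ≤ ∫ v, (J v + J (ρ v)) ∂(uniformSphere d) := by
          refine integral_mono_ae
            (integrable_uniformSphere_of_continuous hd (by fun_prop)) (hJi.add hJi') ?_
          filter_upwards [ae_norm_eq_one_uniformSphere d] with v hv using hpt v hv
      _ = 2 * ∫ v, J v ∂(uniformSphere d) := by
          rw [integral_add hJi hJi', integral_comp_linearIsometryEquiv_uniformSphere ρ J]
          ring
  have hfin : ∫ v, inner ℝ (((d : ℝ) / δ * (F (x + δ • v) - b)) • v) w ∂(uniformSphere d) =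
      (d : ℝ) / δ * ∫ v, J v ∂(uniformSphere d) := by
    rw [← integral_const_mul]
    refine integral_congr_ae (Filter.Eventually.of_forall fun v => ?_)
    simp only [hJ, real_inner_smul_left]
    ring
  rw [hfin]
  calc F x - F y - 2 * L * δ = (d : ℝ) / δ / 2 *
        (2 * δ / ‖w‖ ^ 2 * (F x - F y - 2 * L * δ) * (‖w‖ ^ 2 / d)) := by field_simp
    _ ≤ (d : ℝ) / δ / 2 * (2 * ∫ v, J v ∂(uniformSphere d)) := by gcongr
    _ = _ := by ring

/-! ### The pathwise estimate -/

theorem theta_nonneg {N d : ℕ} (X : Set (Vec d)) (δ : ℝ) (f : ℤ → Fin N → Vec d → ℝ) (t : ℤ)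
    (i : Fin N) : 0 ≤ theta X δ f t i :=
  Real.sSup_nonneg (by rintro _ ⟨z, -, rfl⟩; exact abs_nonneg _)

theorem abs_sub_le_theta {N d : ℕ} {X : Set (Vec d)} {δ L r : ℝ} (hδ : 0 ≤ δ) (hL0 : 0 ≤ L)
    (hX : X ⊆ Metric.closedBall 0 r) {f : ℤ → Fin N → Vec d → ℝ} {t : ℤ} {i : Fin N}
    (h : ∀ y ∈ enlargement X δ, ∀ z ∈ enlargement X δ, |f t i y - f t i z| ≤ L * ‖y - z‖)
    (h' : ∀ y ∈ enlargement X δ, ∀ z ∈ enlargement X δ,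
      |f (t - 1) i y - f (t - 1) i z| ≤ L * ‖y - z‖)
    {z : Vec d} (hz : z ∈ queryRegion X δ) :
    |f t i z - f (t - 1) i z| ≤ theta X δ f t i := by
  refine le_csSup ?_ ⟨z, hz, rfl⟩
  -- On the bounded query region both losses stay close to their values at the base point of `z`.
  obtain ⟨x, hx, -, -, -⟩ := hz
  refine ⟨L * (2 * r + δ) + L * (2 * r + δ) + |f t i x - f (t - 1) i x|, ?_⟩
  rintro _ ⟨_, ⟨y, hy, v, hv, rfl⟩, rfl⟩
  have hyx : ‖y + δ • v - x‖ ≤ 2 * r + δ := by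
    have h1 : ‖y‖ ≤ r := by simpa using hX hy
    have h2 : ‖x‖ ≤ r := by simpa using hX hx
    have h3 : ‖δ • v‖ = δ := by rw [norm_smul, hv, mul_one, Real.norm_of_nonneg hδ]
    linarith [norm_sub_le (y + δ • v) x, norm_add_le y (δ • v)]
  have hm := add_smul_mem_enlargement δ hy hv
  have hm' := mem_enlargement_of_mem δ hx
  have h1 := (h _ hm _ hm').trans (mul_le_mul_of_nonneg_left hyx hL0)
  have h2 := (h' _ hm _ hm').trans (mul_le_mul_of_nonneg_left hyx hL0)
  rw [abs_le] at h1 h2 ⊢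
  constructor <;>
    linarith [le_abs_self (f t i x - f (t - 1) i x), neg_abs_le (f t i x - f (t - 1) i x)]

theorem norm_orfEstimator_sq_le {N d : ℕ} {X : Set (Vec d)} {δ L r : ℝ} (hδ : 0 < δ) (hL0 : 0 ≤ L)
    (hX : X ⊆ Metric.closedBall 0 r) {f : ℤ → Fin N → Vec d → ℝ} {t : ℤ} {i : Fin N}
    (h : ∀ y ∈ enlargement X δ, ∀ z ∈ enlargement X δ, |f t i y - f t i z| ≤ L * ‖y - z‖)
    (h' : ∀ y ∈ enlargement X δ, ∀ z ∈ enlargement X δ,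
      |f (t - 1) i y - f (t - 1) i z| ≤ L * ‖y - z‖)
    {u x : ℤ → Fin N → Vec d} (hu : ‖u t i‖ = 1) (hu' : ‖u (t - 1) i‖ = 1)
    (hx : x t i ∈ X) (hx' : x (t - 1) i ∈ X) :
    ‖orfEstimator δ f u x t i‖ ^ 2 ≤ 3 * (d : ℝ) ^ 2 / δ ^ 2 *
      (theta X δ f t i ^ 2 + L ^ 2 * ‖x t i - x (t - 1) i‖ ^ 2 + 4 * L ^ 2 * δ ^ 2) := by
  set a := f t i (x t i + δ • u t i) - f (t - 1) i (x (t - 1) i + δ • u (t - 1) i) with ha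
  set s := ‖x t i - x (t - 1) i‖
  have h1 := abs_sub_le_theta hδ.le hL0 hX h h' (add_smul_mem_queryRegion δ hx hu)
  have h2 := h' _ (add_smul_mem_enlargement δ hx hu) _ (add_smul_mem_enlargement δ hx' hu')
  have h3 : ‖x t i + δ • u t i - (x (t - 1) i + δ • u (t - 1) i)‖ ≤ s + 2 * δ := by
    have e : x t i + δ • u t i - (x (t - 1) i + δ • u (t - 1) i) =
        (x t i - x (t - 1) i) + δ • (u t i - u (t - 1) i) := by module
    rw [e]
    refine (norm_add_le _ _).trans ?_
    rw [norm_smul, Real.norm_of_nonneg hδ.le]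
    have := norm_sub_le (u t i) (u (t - 1) i)
    rw [hu, hu'] at this
    nlinarith
  have h4 : |a| ≤ theta X δ f t i + L * s + 2 * L * δ := by
    have := abs_add_le (f t i (x t i + δ • u t i) - f (t - 1) i (x t i + δ • u t i))
      (f (t - 1) i (x t i + δ • u t i) - f (t - 1) i (x (t - 1) i + δ • u (t - 1) i))
    rw [sub_add_sub_cancel] at this
    nlinarith [mul_le_mul_of_nonneg_left h3 hL0]
  have h5 : a ^ 2 ≤ 3 * (theta X δ f t i ^ 2 + L ^ 2 * s ^ 2 + 4 * L ^ 2 * δ ^ 2) := by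
    calc a ^ 2 = |a| ^ 2 := (sq_abs a).symm
      _ ≤ (theta X δ f t i + L * s + 2 * L * δ) ^ 2 := by gcongr
      _ ≤ _ := by
        nlinarith [sq_nonneg (theta X δ f t i - L * s), sq_nonneg (theta X δ f t i - 2 * L * δ),
          sq_nonneg (L * s - 2 * L * δ)]
  rw [orfEstimator, norm_smul, hu, mul_one, Real.norm_eq_abs, sq_abs, ← ha, mul_pow, div_pow]
  calc (d : ℝ) ^ 2 / δ ^ 2 * a ^ 2 ≤ (d : ℝ) ^ 2 / δ ^ 2 *
        (3 * (theta X δ f t i ^ 2 + L ^ 2 * s ^ 2 + 4 * L ^ 2 * δ ^ 2)) := by gcongr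
    _ = _ := by ring

/-- One round of averaged projected descent along arbitrary directions `g`. Both the distance to
the comparator `z` and the distance travelled by the agents are controlled. -/
theorem sum_norm_step_sub_sq_add_le {N d : ℕ} {X : Set (Vec d)} (hX : Convex ℝ X)
    {A : Matrix (Fin N) (Fin N) ℝ} {κ : ℝ} (hκ : 0 ≤ κ) (hA : ∀ i j, 0 ≤ A i j)
    (hdiag : ∀ i, κ ≤ A i i) (hrow : ∀ i, ∑ j, A i j = 1) (hcol : ∀ j, ∑ i, A i j = 1)
    (η : ℝ) {x x' g : Fin N → Vec d} (hx : ∀ i, x i ∈ X)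
    (hx' : ∀ i, IsProj X (∑ j, A i j • (x j - η • g j)) (x' i)) {z : Vec d} (hz : z ∈ X) :
    ∑ i, ‖x' i - z‖ ^ 2 + κ / 2 * ∑ i, ‖x' i - x i‖ ^ 2 ≤
      ∑ i, ‖x i - z‖ ^ 2 - 2 * η * ∑ i, inner ℝ (g i) (x i - z) +
        (1 + κ) * η ^ 2 * ∑ i, ‖g i‖ ^ 2 := by
  have h1 := sum_norm_average_sub_sq_add_le hA hdiag hrow hcol (fun j => x j - η • g j) z
  have h2 : ∑ i, ‖x' i - z‖ ^ 2 ≤ ∑ i, ‖∑ j, A i j • (x j - η • g j) - z‖ ^ 2 := by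
    refine Finset.sum_le_sum fun i _ => ?_
    gcongr
    exact (hx' i).norm_sub_le_norm_sub hX (isProj_self hz)
  have h3 : ∑ i, ‖x' i - x i‖ ^ 2 ≤
      2 * ∑ i, ‖x i - η • g i - ∑ j, A i j • (x j - η • g j)‖ ^ 2 +
        2 * η ^ 2 * ∑ i, ‖g i‖ ^ 2 := by
    rw [Finset.mul_sum, Finset.mul_sum, ← Finset.sum_add_distrib]
    refine Finset.sum_le_sum fun i _ => ?_
    set m := ∑ j, A i j • (x j - η • g j)
    have h4 : ‖x' i - x i‖ ≤ ‖x i - η • g i - m‖ + |η| * ‖g i‖ := by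
      refine ((hx' i).norm_sub_le_norm_sub hX (isProj_self (hx i))).trans ?_
      rw [← norm_neg (m - x i), ← Real.norm_eq_abs η, ← norm_smul]
      refine le_trans (le_of_eq ?_) (norm_add_le _ _)
      congr 1
      abel
    calc ‖x' i - x i‖ ^ 2 ≤ (‖x i - η • g i - m‖ + |η| * ‖g i‖) ^ 2 := by gcongr
      _ ≤ 2 * ‖x i - η • g i - m‖ ^ 2 + 2 * (|η| ^ 2 * ‖g i‖ ^ 2) := by
        nlinarith [sq_nonneg (‖x i - η • g i - m‖ - |η| * ‖g i‖)]
      _ = _ := by rw [sq_abs]; ring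
  have h5 : ∑ i, ‖x i - η • g i - z‖ ^ 2 = ∑ i, ‖x i - z‖ ^ 2 -
      2 * η * ∑ i, inner ℝ (g i) (x i - z) + η ^ 2 * ∑ i, ‖g i‖ ^ 2 := by
    rw [Finset.mul_sum, Finset.mul_sum, ← Finset.sum_sub_distrib, ← Finset.sum_add_distrib]
    refine Finset.sum_congr rfl fun i _ => ?_
    rw [show x i - η • g i - z = (x i - z) - η • g i by abel, norm_sub_sq_real,
      real_inner_smul_right, real_inner_comm, norm_smul, mul_pow, Real.norm_eq_abs, sq_abs]
    ring
  have h6 := mul_le_mul_of_nonneg_left h3 (by positivity : 0 ≤ κ / 2)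
  rw [h5] at h1
  linarith

/-- The closed feedback loop: the estimators are bounded by the distances travelled, which are in
turn bounded by the estimators. For small steps the loop is a contraction, and the total of the
inner products `I n` is bounded: if it is positive it only helps in bounding the distances, and
otherwise the claim is trivial. -/
theorem sum_le_of_feedback {T : ℕ} {D S I Γ θ : ℕ → ℝ} {κ η K l e D₀ : ℝ} (hκ : 0 < κ)
    (hη : 0 < η) (hK : 0 ≤ K) (hl : 0 ≤ l) (he : 0 ≤ e) (hD : ∀ n, 0 ≤ D n) (hS : ∀ n, 0 ≤ S n)
    (hθ : ∀ n, 0 ≤ θ n) (hD₀ : D 0 ≤ D₀) (hS₀ : S 0 ≤ D₀)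
    (hstep : ∀ n < T, D (n + 1) + κ / 2 * S (n + 1) ≤
      D n - 2 * η * I n + (1 + κ) * η ^ 2 * Γ n)
    (hΓ : ∀ n < T, Γ n ≤ K * (θ n + l * S n + e))
    (hsmall : K * l * (2 / κ) * (1 + κ) * η ^ 2 ≤ 1 / 2) :
    ∑ n ∈ Finset.range T, I n ≤ D₀ / (2 * η) + (1 + κ) * η * K *
      (∑ n ∈ Finset.range T, θ n + e * T + l * (D₀ * (1 + 2 / κ))) := by
  have hDpos : 0 ≤ D₀ := (hD 0).trans hD₀
  have hθs : 0 ≤ ∑ n ∈ Finset.range T, θ n := Finset.sum_nonneg fun n _ => hθ n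
  rcases le_or_gt (∑ n ∈ Finset.range T, I n) 0 with hI | hI
  · exact hI.trans (by positivity)
  have h1 : D T + κ / 2 * ∑ n ∈ Finset.range T, S (n + 1) ≤ D 0 -
      2 * η * ∑ n ∈ Finset.range T, I n + (1 + κ) * η ^ 2 * ∑ n ∈ Finset.range T, Γ n := by
    have := Finset.sum_le_sum fun n hn => hstep n (Finset.mem_range.1 hn)
    simp only [Finset.sum_add_distrib, Finset.sum_sub_distrib, ← Finset.mul_sum] at this
    linarith [Finset.sum_range_sub D T, Finset.sum_sub_distrib (s := Finset.range T)
      (fun n => D (n + 1)) D]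
  have h2 : ∑ n ∈ Finset.range T, S n ≤ D₀ + ∑ n ∈ Finset.range T, S (n + 1) := by
    linarith [Finset.sum_range_succ S T, Finset.sum_range_succ' S T, hS T]
  have h3 : ∑ n ∈ Finset.range T, Γ n ≤
      K * (∑ n ∈ Finset.range T, θ n + l * ∑ n ∈ Finset.range T, S n + e * T) := by
    have := Finset.sum_le_sum fun n hn => hΓ n (Finset.mem_range.1 hn)
    simp only [Finset.sum_add_distrib, ← Finset.mul_sum, Finset.sum_const, Finset.card_range,
      nsmul_eq_mul] at this
    linarith
  set I' := ∑ n ∈ Finset.range T, I n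
  set Γ' := ∑ n ∈ Finset.range T, Γ n
  set θ' := ∑ n ∈ Finset.range T, θ n
  set S' := ∑ n ∈ Finset.range T, S n
  set S'' := ∑ n ∈ Finset.range T, S (n + 1)
  have hη2 : 0 < 2 * η * I' := by positivity
  have h4 : S'' ≤ 2 / κ * (D₀ + (1 + κ) * η ^ 2 * Γ') := by
    rw [div_mul_eq_mul_div, le_div_iff₀ hκ]
    linarith [hD T]
  have h5 : Γ' ≤ K * (θ' + e * T + l * (D₀ * (1 + 2 / κ))) +
      K * l * (2 / κ) * (1 + κ) * η ^ 2 * Γ' := by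
    have h6 : S' ≤ D₀ * (1 + 2 / κ) + 2 / κ * (1 + κ) * η ^ 2 * Γ' := by linarith
    have h7 := mul_le_mul_of_nonneg_left (mul_le_mul_of_nonneg_left h6 hl) hK
    linarith
  have h8 : Γ' ≤ 2 * (K * (θ' + e * T + l * (D₀ * (1 + 2 / κ)))) := by
    have hB : 0 ≤ K * (θ' + e * T + l * (D₀ * (1 + 2 / κ))) := by positivity
    rcases le_or_gt Γ' 0 with h | h
    · linarith
    · linarith [mul_le_mul_of_nonneg_right hsmall h.le]
  have h9 : 2 * η * I' ≤ D₀ + (1 + κ) * η ^ 2 *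
      (2 * (K * (θ' + e * T + l * (D₀ * (1 + 2 / κ))))) := by
    have : (1 + κ) * η ^ 2 * Γ' ≤ (1 + κ) * η ^ 2 *
      (2 * (K * (θ' + e * T + l * (D₀ * (1 + 2 / κ))))) := by gcongr
    have : 0 ≤ κ / 2 * S'' := mul_nonneg (by positivity) (Finset.sum_nonneg fun n _ => hS _)
    linarith [hD T]
  calc I' = (2 * η * I') / (2 * η) := by field_simp
    _ ≤ (D₀ + (1 + κ) * η ^ 2 *
      (2 * (K * (θ' + e * T + l * (D₀ * (1 + 2 / κ)))))) / (2 * η) := by gcongr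
    _ = _ := by field_simp

theorem sum_Icc_one_int {M : Type*} [AddCommMonoid M] (h : ℤ → M) (T : ℕ) :
    ∑ t ∈ Finset.Icc (1 : ℤ) T, h t = ∑ n ∈ Finset.range T, h ((n : ℤ) + 1) := by
  induction T with
  | zero => simp
  | succ T ih =>
    rw [Finset.sum_range_succ, ← ih]
    have : Finset.Icc (1 : ℤ) ((T + 1 : ℕ) : ℤ) =
        insert ((T : ℤ) + 1) (Finset.Icc (1 : ℤ) T) := by
      ext t
      simp only [Finset.mem_Icc, Finset.mem_insert]
      push_cast
      omega
    rw [this, Finset.sum_insert (by simp), add_comm]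

theorem sum_theta_sq_le_Theta_sq {N d : ℕ} (X : Set (Vec d)) (δ : ℝ) (f : ℤ → Fin N → Vec d → ℝ)
    (T : ℕ) : ∑ t ∈ Finset.Icc (1 : ℤ) T, ∑ i, theta X δ f t i ^ 2 ≤ Theta X δ f T ^ 2 := by
  refine le_trans (Finset.sum_le_sum fun t _ => Finset.sum_sq_le_sq_sum_of_nonneg
    fun i _ => theta_nonneg X δ f t i) ?_
  exact Finset.sum_sq_le_sq_sum_of_nonneg fun t _ => Finset.sum_nonneg fun i _ => theta_nonneg X δ f t i

theorem IsRun.mem {N d : ℕ} {X : Set (Vec d)} {A : Matrix (Fin N) (Fin N) ℝ} {η δ : ℝ}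
    {f : ℤ → Fin N → Vec d → ℝ} {T : ℕ} {xprev xinit : Fin N → Vec d} {u x : ℤ → Fin N → Vec d}
    (h : IsRun X A η δ f T xprev xinit u x) (hprev : ∀ i, xprev i ∈ X) (hinit : ∀ i, xinit i ∈ X)
    {t : ℤ} (ht : -1 ≤ t) (htT : t ≤ T + 1) (i : Fin N) : x t i ∈ X := by
  rcases (by omega : t = -1 ∨ t = 0 ∨ (0 ≤ t - 1 ∧ t - 1 ≤ T)) with rfl | rfl | ⟨h0, hT⟩
  · rw [h.start_prev]; exact hprev i
  · rw [h.start]; exact hinit i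
  · simpa using (h.step (t - 1) h0 hT i).1

/-- On every sample path the linearized regret along the estimators is bounded. -/
theorem IsRun.sum_inner_orfEstimator_le {N d : ℕ} {X : Set (Vec d)} (hX : Convex ℝ X) {r : ℝ}
    (hXr : X ⊆ Metric.closedBall 0 r) {G : SimpleGraph (Fin N)} {A : Matrix (Fin N) (Fin N) ℝ}
    {ε κ : ℝ} (hε : 0 < ε) (hκ : 0 < κ) (hA : IsWeightMatrix G A ε κ) {η δ L : ℝ} (hη : 0 < η)
    (hδ : 0 < δ) (hL0 : 0 ≤ L) {f : ℤ → Fin N → Vec d → ℝ} {T : ℕ}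
    (hL : ∀ t : ℤ, -1 ≤ t → t ≤ T → ∀ i, ∀ y ∈ enlargement X δ, ∀ z ∈ enlargement X δ,
      |f t i y - f t i z| ≤ L * ‖y - z‖)
    {xprev xinit : Fin N → Vec d} (hprev : ∀ i, xprev i ∈ X) (hinit : ∀ i, xinit i ∈ X)
    {u x : ℤ → Fin N → Vec d} (hu : ∀ t : ℤ, -1 ≤ t → t ≤ T → ∀ i, ‖u t i‖ = 1)
    (h : IsRun X A η δ f T xprev xinit u x)
    (hsmall : 3 * (d : ℝ) ^ 2 / δ ^ 2 * L ^ 2 * (2 / κ) * (1 + κ) * η ^ 2 ≤ 1 / 2)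
    {z : Vec d} (hz : z ∈ X) :
    ∑ t ∈ Finset.Icc (1 : ℤ) T, ∑ i, inner ℝ (orfEstimator δ f u x t i) (x t i - z) ≤
      N * (4 * r ^ 2) / (2 * η) + (1 + κ) * η * (3 * (d : ℝ) ^ 2 / δ ^ 2) *
        (Theta X δ f T ^ 2 + N * (4 * L ^ 2 * δ ^ 2) * T +
          L ^ 2 * (N * (4 * r ^ 2) * (1 + 2 / κ))) := by
  have hdist : ∀ y ∈ X, ∀ z ∈ X, ‖y - z‖ ^ 2 ≤ 4 * r ^ 2 := by
    intro y hy z hz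
    have h1 : ‖y‖ ≤ r := by simpa using hXr hy
    have h2 : ‖z‖ ≤ r := by simpa using hXr hz
    have h3 : ‖y - z‖ ≤ 2 * r := by linarith [norm_sub_le y z]
    calc ‖y - z‖ ^ 2 ≤ (2 * r) ^ 2 := by gcongr
      _ = _ := by ring
  have hmem : ∀ t : ℤ, -1 ≤ t → t ≤ T + 1 → ∀ i, x t i ∈ X := fun t h1 h2 i =>
    h.mem hprev hinit h1 h2 i
  have hsum4 : ∀ y y' : Fin N → Vec d, (∀ i, y i ∈ X) → (∀ i, y' i ∈ X) →
      ∑ i, ‖y i - y' i‖ ^ 2 ≤ N * (4 * r ^ 2) := by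
    intro y y' hy hy'
    refine (Finset.sum_le_sum fun i _ => hdist _ (hy i) _ (hy' i)).trans (le_of_eq ?_)
    simp
  have hmain := sum_le_of_feedback (T := T)
    (D := fun n => ∑ i, ‖x ((n : ℤ) + 1) i - z‖ ^ 2)
    (S := fun n => ∑ i, ‖x ((n : ℤ) + 1) i - x ((n : ℤ) + 1 - 1) i‖ ^ 2)
    (I := fun n => ∑ i, inner ℝ (orfEstimator δ f u x ((n : ℤ) + 1) i) (x ((n : ℤ) + 1) i - z))
    (Γ := fun n => ∑ i, ‖orfEstimator δ f u x ((n : ℤ) + 1) i‖ ^ 2)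
    (θ := fun n => ∑ i, theta X δ f ((n : ℤ) + 1) i ^ 2)
    (κ := κ) (η := η) (K := 3 * (d : ℝ) ^ 2 / δ ^ 2) (l := L ^ 2) (e := N * (4 * L ^ 2 * δ ^ 2))
    (D₀ := N * (4 * r ^ 2)) hκ hη (by positivity) (by positivity) (by positivity)
    (fun n => by positivity) (fun n => by positivity) (fun n => by positivity)
    (hsum4 _ _ (fun i => hmem _ (by omega) (by omega) i) fun _ => hz)
    (hsum4 _ _ (fun i => hmem _ (by omega) (by omega) i)
      (fun i => hmem _ (by omega) (by omega) i))
    ?_ ?_ hsmall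
  · rw [sum_Icc_one_int]
    refine hmain.trans ?_
    have := sum_theta_sq_le_Theta_sq X δ f T
    rw [sum_Icc_one_int] at this
    gcongr
  · intro n hn
    have := sum_norm_step_sub_sq_add_le hX hκ.le (hA.nonneg hε.le hκ.le) hA.diag hA.row_sum
      hA.col_sum η (hmem ((n : ℤ) + 1) (by omega) (by omega))
      (h.step ((n : ℤ) + 1) (by omega) (by omega)) hz
    simpa using this
  · intro n hn
    calc ∑ i, ‖orfEstimator δ f u x ((n : ℤ) + 1) i‖ ^ 2
        ≤ ∑ i, 3 * (d : ℝ) ^ 2 / δ ^ 2 * (theta X δ f ((n : ℤ) + 1) i ^ 2 +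
          L ^ 2 * ‖x ((n : ℤ) + 1) i - x ((n : ℤ) + 1 - 1) i‖ ^ 2 + 4 * L ^ 2 * δ ^ 2) :=
          Finset.sum_le_sum fun i _ => norm_orfEstimator_sq_le hδ hL0 hXr
            (hL _ (by omega) (by omega) i) (hL _ (by omega) (by omega) i)
            (hu _ (by omega) (by omega) i) (hu _ (by omega) (by omega) i)
            (hmem _ (by omega) (by omega) i) (hmem _ (by omega) (by omega) i)
      _ = _ := by
          simp only [← Finset.mul_sum, Finset.sum_add_distrib, Finset.sum_const, Finset.card_univ,
            Fintype.card_fin, nsmul_eq_mul]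
          ring

/-! ### Measurability and independence of the iterates -/

theorem ae_norm_eq_one_of_hasLaw {d : ℕ} {Ω : Type*} [MeasurableSpace Ω] {P : Measure Ω}
    {u : Ω → Vec d} (hu : HasLaw u (uniformSphere d) P) : ∀ᵐ ω ∂P, ‖u ω‖ = 1 := by
  have := ae_norm_eq_one_uniformSphere d
  rw [← hu.map_eq] at this
  exact ae_of_ae_map hu.aemeasurable this

/-- A measurable version of a uniform direction that has norm one at every sample point. -/
theorem exists_measurable_norm_eq_one {d : ℕ} (hd : 1 ≤ d) {Ω : Type*} [MeasurableSpace Ω]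
    {P : Measure Ω} {u : Ω → Vec d} (hu : HasLaw u (uniformSphere d) P) :
    ∃ v : Ω → Vec d, Measurable v ∧ (∀ ω, ‖v ω‖ = 1) ∧ v =ᵐ[P] u := by
  classical
  obtain ⟨v, hv, huv⟩ := hu.aemeasurable
  have hset : MeasurableSet {y : Vec d | ‖y‖ = 1} :=
    measurableSet_eq_fun measurable_norm measurable_const
  have h1 := ae_norm_eq_one_of_hasLaw hu
  refine ⟨fun ω => if ‖v ω‖ = 1 then v ω else EuclideanSpace.single ⟨0, hd⟩ 1,
    Measurable.ite (hv hset) hv measurable_const, fun ω => ?_, ?_⟩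
  · by_cases h : ‖v ω‖ = 1 <;> simp [h]
  · filter_upwards [huv, h1] with ω h2 h3
    rw [h2] at h3
    simp [h3, h2]

/-- The information available before round `t`: the σ-algebra generated by the directions of the
rounds `s` with `-1 ≤ s ≤ T` and `s < t`. -/
@[reducible] def past {N d : ℕ} {Ω : Type*} (u : ℤ → Fin N → Ω → Vec d) (T : ℕ) (t : ℤ) :
    MeasurableSpace Ω :=
  ⨆ p ∈ {p : Set.Icc (-1 : ℤ) (T : ℤ) × Fin N | (p.1 : ℤ) < t},
    MeasurableSpace.comap (u (p.1 : ℤ) p.2) inferInstance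

theorem past_mono {N d : ℕ} {Ω : Type*} (u : ℤ → Fin N → Ω → Vec d) (T : ℕ) {s t : ℤ}
    (h : s ≤ t) : past u T s ≤ past u T t :=
  biSup_mono fun _ hp => lt_of_lt_of_le hp h

theorem past_le {N d : ℕ} {Ω : Type*} [m : MeasurableSpace Ω] {u : ℤ → Fin N → Ω → Vec d}
    (hu : ∀ t i, Measurable (u t i)) (T : ℕ) (t : ℤ) : past u T t ≤ m :=
  iSup₂_le fun p _ => (hu p.1 p.2).comap_le

theorem measurable_past {N d : ℕ} {Ω : Type*} (u : ℤ → Fin N → Ω → Vec d) {T : ℕ} {s t : ℤ}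
    (hs : -1 ≤ s) (hsT : s ≤ T) (hst : s < t) (i : Fin N) : Measurable[past u T t] (u s i) := by
  refine Measurable.of_comap_le ?_
  exact le_iSup₂_of_le (f := fun (p : Set.Icc (-1 : ℤ) (T : ℤ) × Fin N)
    (_ : p ∈ {p : Set.Icc (-1 : ℤ) (T : ℤ) × Fin N | (p.1 : ℤ) < t}) =>
      MeasurableSpace.comap (u (p.1 : ℤ) p.2) inferInstance) (⟨s, hs, hsT⟩, i) hst le_rfl

theorem indep_past {N d : ℕ} {Ω : Type*} [MeasurableSpace Ω] {P : Measure Ω}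
    {u : ℤ → Fin N → Ω → Vec d} (hu : ∀ t i, Measurable (u t i)) {T : ℕ}
    (h : iIndepFun (fun p : Set.Icc (-1 : ℤ) (T : ℤ) × Fin N => u (p.1 : ℤ) p.2) P)
    {t : ℤ} (ht : -1 ≤ t) (htT : t ≤ T) (i : Fin N) :
    Indep (past u T t) (MeasurableSpace.comap (u t i) inferInstance) P := by
  have := indep_iSup_of_disjoint (fun p => (hu p.1 p.2).comap_le) h.iIndep
    (S := {p : Set.Icc (-1 : ℤ) (T : ℤ) × Fin N | (p.1 : ℤ) < t}) (T := {(⟨t, ht, htT⟩, i)})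
    (by rw [Set.disjoint_singleton_right]; simp)
  simp only [Set.mem_singleton_iff, iSup_iSup_eq_left] at this
  exact this

theorem measurable_step {N d : ℕ} {Ω : Type*} [MeasurableSpace Ω] {π : Vec d → Vec d}
    (hπ : Continuous π) (a : Fin N → ℝ) (η c δ : ℝ) {F F' : Fin N → Vec d → ℝ}
    (hF : ∀ j, Continuous (F j)) (hF' : ∀ j, Continuous (F' j)) {φ φ' v v' : Fin N → Ω → Vec d}
    (hφ : ∀ j, Measurable (φ j)) (hφ' : ∀ j, Measurable (φ' j)) (hv : ∀ j, Measurable (v j))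
    (hv' : ∀ j, Measurable (v' j)) :
    Measurable fun ω => π (∑ j, a j • (φ j ω - η • ((c * (F j (φ j ω + δ • v j ω) -
      F' j (φ' j ω + δ • v' j ω))) • v j ω))) := by
  have h1 := fun j => (hF j).measurable
  have h2 := fun j => (hF' j).measurable
  have h3 := hπ.measurable
  fun_prop

/-- Each iterate agrees almost surely with a random vector that depends on the past directions
only. -/
theorem exists_measurable_past_iterate {N d : ℕ} {X : Set (Vec d)} {π : Vec d → Vec d}
    (hπ : Continuous π) (hπX : ∀ y p, IsProj X y p ↔ p = π y) {A : Matrix (Fin N) (Fin N) ℝ}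
    {η δ : ℝ} {f F : ℤ → Fin N → Vec d → ℝ} (hF : ∀ t i, Continuous (F t i)) {T : ℕ}
    (hfF : ∀ t : ℤ, -1 ≤ t → t ≤ T → ∀ i, Set.EqOn (f t i) (F t i) (enlargement X δ))
    {xprev xinit : Fin N → Vec d} {Ω : Type*} [MeasurableSpace Ω] {P : Measure Ω}
    {u v x : ℤ → Fin N → Ω → Vec d}
    (hx : ∀ ω, IsRun X A η δ f T xprev xinit (fun t i => u t i ω) (fun t i => x t i ω))
    (hmem : ∀ ω, ∀ t : ℤ, -1 ≤ t → t ≤ T → ∀ i, x t i ω ∈ X)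
    (hv : ∀ t i ω, ‖v t i ω‖ = 1)
    (huv : ∀ᵐ ω ∂P, ∀ t : ℤ, -1 ≤ t → t ≤ T → ∀ i, u t i ω = v t i ω) (n : ℕ) (hn : n ≤ T) :
    ∀ i, (∃ φ : Ω → Vec d, Measurable[past v T n] φ ∧ φ =ᵐ[P] x ((n : ℤ) - 1) i) ∧
      ∃ φ : Ω → Vec d, Measurable[past v T n] φ ∧ φ =ᵐ[P] x n i := by
  induction n with
  | zero =>
    refine fun i => ⟨⟨fun _ => xprev i, @measurable_const _ _ _ (past v T _) _, ?_⟩,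
      ⟨fun _ => xinit i, @measurable_const _ _ _ (past v T _) _, ?_⟩⟩
    · exact Filter.Eventually.of_forall fun ω => ((hx ω).start_prev i).symm
    · exact Filter.Eventually.of_forall fun ω => ((hx ω).start i).symm
  | succ n ih =>
    have ih := ih (by omega)
    choose φ' hφ' hφ'x using fun i => (ih i).1
    choose φ hφ hφx using fun i => (ih i).2
    have hle : past v T n ≤ past v T (n + 1 : ℕ) := past_mono v T (by push_cast; omega)
    intro i
    refine ⟨⟨φ i, (hφ i).mono hle le_rfl, by simpa using hφx i⟩, ⟨_, @measurable_step N d Ω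
      (past v T (n + 1 : ℕ)) π hπ (A i) η (d / δ) δ (F n) (F ((n : ℤ) - 1)) (hF _) (hF _) φ φ'
      (v n) (v ((n : ℤ) - 1)) (fun j => (hφ j).mono hle le_rfl) (fun j => (hφ' j).mono hle le_rfl)
      (measurable_past v (by omega) (by omega) (by push_cast; omega))
      (measurable_past v (by omega) (by omega) (by push_cast; omega)), ?_⟩⟩
    filter_upwards [huv, ae_all_iff.2 hφx, ae_all_iff.2 hφ'x] with ω h1 h2 h3
    have hstep := (hπX _ _).1 ((hx ω).step n (by omega) (by omega) i)
    push_cast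
    rw [hstep]
    congr 1
    refine Finset.sum_congr rfl fun j _ => ?_
    have e1 := h1 n (by omega) (by omega) j
    have e2 := h1 ((n : ℤ) - 1) (by omega) (by omega) j
    have m1 := hfF n (by omega) (by omega) j
      (add_smul_mem_enlargement δ (hmem ω n (by omega) (by omega) j) (hv n j ω))
    have m2 := hfF ((n : ℤ) - 1) (by omega) (by omega) j
      (add_smul_mem_enlargement δ (hmem ω ((n : ℤ) - 1) (by omega) (by omega) j)
        (hv ((n : ℤ) - 1) j ω))
    simp only [orfEstimator, e1, e2, m1, m2, h2, h3]

theorem integral_le_integral_of_indepFun {Ω E E' : Type*} [MeasurableSpace Ω] [MeasurableSpace E]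
    [MeasurableSpace E'] {P : Measure Ω} [IsProbabilityMeasure P] {ξ : Ω → E} {v : Ω → E'}
    (hξ : Measurable ξ) (hv : Measurable v) (hind : IndepFun ξ v P) {H : E × E' → ℝ}
    (hH : Measurable H) (hHi : Integrable (fun ω => H (ξ ω, v ω)) P) {h : E → ℝ}
    (hi : Integrable (fun ω => h (ξ ω)) P)
    (hle : ∀ᵐ ω ∂P, h (ξ ω) ≤ ∫ y, H (ξ ω, y) ∂(P.map v)) :
    ∫ ω, h (ξ ω) ∂P ≤ ∫ ω, H (ξ ω, v ω) ∂P := by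
  have hprod := (indepFun_iff_map_prod_eq_prod_map_map hξ.aemeasurable hv.aemeasurable).1 hind
  have := Measure.isProbabilityMeasure_map (μ := P) hξ.aemeasurable
  have := Measure.isProbabilityMeasure_map (μ := P) hv.aemeasurable
  have hHp : Integrable H ((P.map ξ).prod (P.map v)) := by
    rw [← hprod]
    exact (integrable_map_measure hH.aestronglyMeasurable (hξ.prodMk hv).aemeasurable).2 hHi
  calc ∫ ω, h (ξ ω) ∂P ≤ ∫ ω, (∫ y, H (ξ ω, y) ∂(P.map v)) ∂P :=
        integral_mono_ae hi (hHp.integral_prod_left.comp_measurable hξ) hle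
    _ = ∫ z, (∫ y, H (z, y) ∂(P.map v)) ∂(P.map ξ) :=
        (integral_map hξ.aemeasurable hHp.integral_prod_left.aestronglyMeasurable).symm
    _ = ∫ p, H p ∂((P.map ξ).prod (P.map v)) := (integral_prod _ hHp).symm
    _ = ∫ ω, H (ξ ω, v ω) ∂P := by
        rw [← hprod, integral_map (hξ.prodMk hv).aemeasurable hH.aestronglyMeasurable]

/-! ### The regret in expectation -/

theorem exists_continuous_eqOn_of_lipschitz {E : Type*} [SeminormedAddCommGroup E] {s : Set E}
    {f : E → ℝ} {L : ℝ} (hL0 : 0 ≤ L) (h : ∀ y ∈ s, ∀ z ∈ s, |f y - f z| ≤ L * ‖y - z‖) :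
    ∃ F : E → ℝ, Continuous F ∧ Set.EqOn f F s := by
  have : LipschitzOnWith L.toNNReal f s := LipschitzOnWith.of_dist_le_mul fun y hy z hz => by
    rw [Real.dist_eq, dist_eq_norm, Real.coe_toNNReal L hL0]
    exact h y hy z hz
  obtain ⟨F, hF, hfF⟩ := this.extend_real
  exact ⟨F, hF.continuous, hfF⟩

/-- In every round the expected linearized regret along the estimator dominates the expected
regret, up to the smoothing error `2 L δ`. -/
theorem integrable_and_sub_le_integral_inner_orfEstimator {N d : ℕ} (hd : 1 ≤ d) {X : Set (Vec d)}
    (hXc : IsClosed X) (hX : Convex ℝ X) {r : ℝ} (hXr : X ⊆ Metric.closedBall 0 r)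
    {A : Matrix (Fin N) (Fin N) ℝ} {η δ L : ℝ} (hδ : 0 < δ) (hL0 : 0 ≤ L)
    {f : ℤ → Fin N → Vec d → ℝ} {T : ℕ}
    (hf : ∀ t : ℤ, -1 ≤ t → t ≤ T → ∀ i, ConvexOn ℝ (enlargement X δ) (f t i))
    (hL : ∀ t : ℤ, -1 ≤ t → t ≤ T → ∀ i, ∀ y ∈ enlargement X δ, ∀ z ∈ enlargement X δ,
      |f t i y - f t i z| ≤ L * ‖y - z‖)
    {xprev xinit : Fin N → Vec d} (hprev : ∀ i, xprev i ∈ X) (hinit : ∀ i, xinit i ∈ X)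
    {Ω : Type*} [MeasurableSpace Ω] {P : Measure Ω} [IsProbabilityMeasure P]
    {u x : ℤ → Fin N → Ω → Vec d}
    (hu : ∀ t : ℤ, -1 ≤ t → t ≤ T → ∀ i, HasLaw (u t i) (uniformSphere d) P)
    (hind : iIndepFun (fun p : Set.Icc (-1 : ℤ) (T : ℤ) × Fin N => u (p.1 : ℤ) p.2) P)
    (hx : ∀ ω, IsRun X A η δ f T xprev xinit (fun t i => u t i ω) (fun t i => x t i ω))
    {z : Vec d} (hz : z ∈ X) {t : ℤ} (ht : 1 ≤ t) (htT : t ≤ T) (i : Fin N) :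
    Integrable (fun ω => f t i (x t i ω)) P ∧
      Integrable (fun ω => inner ℝ (orfEstimator δ f (fun t i => u t i ω) (fun t i => x t i ω) t i)
        (x t i ω - z)) P ∧
      ∫ ω, f t i (x t i ω) ∂P - f t i z - 2 * L * δ ≤
        ∫ ω, inner ℝ (orfEstimator δ f (fun t i => u t i ω) (fun t i => x t i ω) t i)
          (x t i ω - z) ∂P := by
  classical
  have hmem : ∀ ω, ∀ t : ℤ, -1 ≤ t → t ≤ T → ∀ i, x t i ω ∈ X := fun ω t h1 h2 i =>
    (hx ω).mem hprev hinit h1 (by omega) i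
  have hdist : ∀ y ∈ X, ‖y - z‖ ≤ 2 * r := by
    intro y hy
    have h1 : ‖y‖ ≤ r := by simpa using hXr hy
    have h2 : ‖z‖ ≤ r := by simpa using hXr hz
    linarith [norm_sub_le y z]
  -- Regular versions of the data: continuous losses, measurable unit directions, and a continuous
  -- projection. They agree with the original data wherever the algorithm looks, almost surely.
  have hFex : ∀ (t : ℤ) (i : Fin N), ∃ F : Vec d → ℝ, Continuous F ∧
      (-1 ≤ t → t ≤ T → Set.EqOn (f t i) F (enlargement X δ)) := by
    intro t i
    by_cases h : -1 ≤ t ∧ t ≤ T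
    · obtain ⟨F, hF, hfF⟩ := exists_continuous_eqOn_of_lipschitz hL0 (hL t h.1 h.2 i)
      exact ⟨F, hF, fun _ _ => hfF⟩
    · exact ⟨fun _ => 0, continuous_const, fun h1 h2 => absurd ⟨h1, h2⟩ h⟩
  choose F hF hfF using hFex
  have hvex : ∀ (t : ℤ) (i : Fin N), ∃ v : Ω → Vec d, Measurable v ∧ (∀ ω, ‖v ω‖ = 1) ∧
      (-1 ≤ t → t ≤ T → v =ᵐ[P] u t i) := by
    intro t i
    by_cases h : -1 ≤ t ∧ t ≤ T
    · obtain ⟨v, hv, hv1, hvu⟩ := exists_measurable_norm_eq_one hd (hu t h.1 h.2 i)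
      exact ⟨v, hv, hv1, fun _ _ => hvu⟩
    · exact ⟨fun _ => EuclideanSpace.single ⟨0, hd⟩ 1, measurable_const, fun _ => by simp,
        fun h1 h2 => absurd ⟨h1, h2⟩ h⟩
  choose v hv hv1 hvu using hvex
  obtain ⟨π, hπ, hπX⟩ := exists_continuous_isProj hXc hX ⟨z, hz⟩
  have huv : ∀ᵐ ω ∂P, ∀ t : ℤ, -1 ≤ t → t ≤ T → ∀ i, u t i ω = v t i ω := by
    rw [ae_all_iff]
    intro t
    by_cases h : -1 ≤ t ∧ t ≤ T
    · filter_upwards [ae_all_iff.2 fun i => hvu t i h.1 h.2] with ω hω _ _ i using (hω i).symm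
    · exact Filter.Eventually.of_forall fun ω h1 h2 => absurd ⟨h1, h2⟩ h
  have hvind : iIndepFun (fun p : Set.Icc (-1 : ℤ) (T : ℤ) × Fin N => v (p.1 : ℤ) p.2) P :=
    hind.congr fun p => (hvu p.1 p.2 p.1.2.1 p.1.2.2).symm
  have hvlaw : P.map (v t i) = uniformSphere d :=
    ((hu t (by omega) htT i).congr (hvu t i (by omega) htT)).map_eq
  obtain ⟨n, rfl⟩ : ∃ n : ℕ, t = n := ⟨t.toNat, by omega⟩
  obtain ⟨⟨φ', hφ'm, hφ'⟩, φ, hφm, hφ⟩ :=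
    exists_measurable_past_iterate hπ hπX hF (fun t h1 h2 i => hfF t i h1 h2) hx hmem hv1 huv n
      (by omega) i
  -- The state before the round: the current iterate and the previous query value.
  set b : Ω → ℝ := fun ω => F ((n : ℤ) - 1) i (φ' ω + δ • v ((n : ℤ) - 1) i ω) with hb
  have hξm : Measurable[past v T n] fun ω => (φ ω, b ω) := by
    refine Measurable.prodMk hφm ((hF _ i).measurable.comp ?_)
    exact hφ'm.add ((measurable_past v (by omega) (by omega) (by omega) i).const_smul δ)
  have hξ : Measurable fun ω => (φ ω, b ω) := hξm.mono (past_le hv T n) le_rfl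
  have hξv : IndepFun (fun ω => (φ ω, b ω)) (v n i) P := by
    rw [IndepFun_iff_Indep]
    exact indep_of_indep_of_le_left (indep_past hv hvind (by omega) htT i) hξm.comap_le
  set H : (Vec d × ℝ) × Vec d → ℝ := fun p =>
    inner ℝ (((d : ℝ) / δ * (F n i (p.1.1 + δ • p.2) - p.1.2)) • p.2) (p.1.1 - z) with hH
  have hHm : Measurable H := by
    have := hF n i
    exact Continuous.measurable (by fun_prop)
  have hgH : (fun ω => inner ℝ (orfEstimator δ f (fun t i => u t i ω) (fun t i => x t i ω) n i)
      (x n i ω - z)) =ᵐ[P] fun ω => H ((φ ω, b ω), v n i ω) := by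
    filter_upwards [huv, hφ, hφ'] with ω h1 h2 h3
    have e1 := h1 n (by omega) htT i
    have e2 := h1 ((n : ℤ) - 1) (by omega) (by omega) i
    have m1 := hfF n i (by omega) htT
      (add_smul_mem_enlargement δ (hmem ω n (by omega) htT i) (hv1 n i ω))
    have m2 := hfF ((n : ℤ) - 1) i (by omega) (by omega)
      (add_smul_mem_enlargement δ (hmem ω ((n : ℤ) - 1) (by omega) (by omega) i)
        (hv1 ((n : ℤ) - 1) i ω))
    simp only [orfEstimator, hH, hb, e1, e2, m1, m2, h2, h3]
  have hfx : (fun ω => f n i (x n i ω)) =ᵐ[P] fun ω => F n i (φ ω) := by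
    filter_upwards [hφ] with ω h
    rw [h]
    exact hfF n i (by omega) htT (mem_enlargement_of_mem δ (hmem ω n (by omega) htT i))
  have hφm' : Measurable φ := hφm.mono (past_le hv T n) le_rfl
  have hint_f : Integrable (fun ω => f n i (x n i ω)) P := by
    refine Integrable.of_bound (((hF n i).measurable.comp hφm').aestronglyMeasurable.congr
      hfx.symm) (L * (2 * r) + |f n i z|) (Filter.Eventually.of_forall fun ω => ?_)
    have h1 := hmem ω n (by omega) htT i
    have h2 := (hL n (by omega) htT i _ (mem_enlargement_of_mem δ h1) _
      (mem_enlargement_of_mem δ hz)).trans (mul_le_mul_of_nonneg_left (hdist _ h1) hL0)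
    rw [Real.norm_eq_abs]
    linarith [abs_sub_abs_le_abs_sub (f n i (x n i ω)) (f n i z)]
  have hint_g : Integrable (fun ω => inner ℝ (orfEstimator δ f (fun t i => u t i ω)
      (fun t i => x t i ω) n i) (x n i ω - z)) P := by
    refine Integrable.of_bound ((hHm.comp (hξ.prodMk (hv n i))).aestronglyMeasurable.congr hgH.symm)
      (√(3 * (d : ℝ) ^ 2 / δ ^ 2 * (theta X δ f n i ^ 2 + L ^ 2 * (2 * r + 2 * r) ^ 2 +
        4 * L ^ 2 * δ ^ 2)) * (2 * r)) ?_
    filter_upwards [huv] with ω h1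
    have hm1 := hmem ω n (by omega) htT i
    have hm2 := hmem ω ((n : ℤ) - 1) (by omega) (by omega) i
    have h2 := norm_orfEstimator_sq_le hδ hL0 hXr (hL n (by omega) htT i)
      (hL ((n : ℤ) - 1) (by omega) (by omega) i) (u := fun t i => u t i ω)
      (x := fun t i => x t i ω) (by rw [h1 n (by omega) htT i]; exact hv1 _ _ _)
      (by rw [h1 ((n : ℤ) - 1) (by omega) (by omega) i]; exact hv1 _ _ _) hm1 hm2
    have h3 : ‖x n i ω - x ((n : ℤ) - 1) i ω‖ ≤ 2 * r + 2 * r := by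
      have := norm_sub_le (x n i ω - z) (x ((n : ℤ) - 1) i ω - z)
      rw [sub_sub_sub_cancel_right] at this
      linarith [hdist _ hm1, hdist _ hm2]
    refine (norm_inner_le_norm _ _).trans ?_
    refine mul_le_mul (Real.le_sqrt_of_sq_le (h2.trans ?_)) (hdist _ hm1) (norm_nonneg _)
      (Real.sqrt_nonneg _)
    gcongr
  refine ⟨hint_f, hint_g, ?_⟩
  have hint_F : Integrable (fun ω => F n i (φ ω)) P := hint_f.congr hfx
  have hmain := integral_le_integral_of_indepFun (P := P) hξ (hv n i) hξv hHm (hint_g.congr hgH)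
    (h := fun p => F n i p.1 - (F n i z + 2 * L * δ)) (hint_F.sub (integrable_const _)) (by
      filter_upwards [hφ] with ω h
      have hφX : φ ω ∈ X := by rw [h]; exact hmem ω n (by omega) htT i
      have := sub_le_integral_estimator hd hδ (hf n (by omega) htT i) hL0
        (hL n (by omega) htT i) (hF n i) (hfF n i (by omega) htT) (b ω) hφX hz
      rw [hvlaw]
      linarith)
  rw [integral_congr_ae hgH, integral_congr_ae hfx,
    hfF n i (by omega) htT (mem_enlargement_of_mem δ hz)]
  rw [integral_sub hint_F (integrable_const _), integral_const, probReal_univ, one_smul] at hmain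
  linarith

/-- A pathwise bound on the linearized regret is inherited by the expected regret. -/
theorem integrable_pathRegret_and_integral_le {N d : ℕ} (hd : 1 ≤ d) {X : Set (Vec d)}
    (hXc : IsClosed X) (hX : Convex ℝ X) {r : ℝ} (hXr : X ⊆ Metric.closedBall 0 r)
    {A : Matrix (Fin N) (Fin N) ℝ} {η δ L : ℝ} (hδ : 0 < δ) (hL0 : 0 ≤ L)
    {f : ℤ → Fin N → Vec d → ℝ} {T : ℕ}
    (hf : ∀ t : ℤ, -1 ≤ t → t ≤ T → ∀ i, ConvexOn ℝ (enlargement X δ) (f t i))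
    (hL : ∀ t : ℤ, -1 ≤ t → t ≤ T → ∀ i, ∀ y ∈ enlargement X δ, ∀ z ∈ enlargement X δ,
      |f t i y - f t i z| ≤ L * ‖y - z‖)
    {xprev xinit : Fin N → Vec d} (hprev : ∀ i, xprev i ∈ X) (hinit : ∀ i, xinit i ∈ X)
    {Ω : Type*} [MeasurableSpace Ω] {P : Measure Ω} [IsProbabilityMeasure P]
    {u x : ℤ → Fin N → Ω → Vec d}
    (hu : ∀ t : ℤ, -1 ≤ t → t ≤ T → ∀ i, HasLaw (u t i) (uniformSphere d) P)
    (hind : iIndepFun (fun p : Set.Icc (-1 : ℤ) (T : ℤ) × Fin N => u (p.1 : ℤ) p.2) P)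
    (hx : ∀ ω, IsRun X A η δ f T xprev xinit (fun t i => u t i ω) (fun t i => x t i ω))
    {z : Vec d} (hz : z ∈ X) :
    Integrable (fun ω => pathRegret f T z (fun t i => x t i ω)) P ∧
      ∀ B : ℝ, (∀ᵐ ω ∂P, ∑ t ∈ Finset.Icc (1 : ℤ) T, ∑ i, inner ℝ
          (orfEstimator δ f (fun t i => u t i ω) (fun t i => x t i ω) t i) (x t i ω - z) ≤ B) →
        ∫ ω, pathRegret f T z (fun t i => x t i ω) ∂P ≤ B + 2 * L * δ * (N * T) := by
  have hround : ∀ t ∈ Finset.Icc (1 : ℤ) T, ∀ i, _ := fun t ht i =>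
    integrable_and_sub_le_integral_inner_orfEstimator hd hXc hX hXr hδ hL0 hf hL hprev hinit hu
      hind hx hz (Finset.mem_Icc.1 ht).1 (Finset.mem_Icc.1 ht).2 i
  have hi1 : ∀ t ∈ Finset.Icc (1 : ℤ) T, ∀ i,
      Integrable (fun ω => f t i (x t i ω) - f t i z) P := fun t ht i =>
    (hround t ht i).1.sub (integrable_const _)
  refine ⟨integrable_finsetSum _ fun t ht => integrable_finsetSum _ fun i _ => hi1 t ht i, ?_⟩
  intro B hB
  have hgI : ∀ t ∈ Finset.Icc (1 : ℤ) T, Integrable (fun ω => ∑ i, inner ℝ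
      (orfEstimator δ f (fun t i => u t i ω) (fun t i => x t i ω) t i) (x t i ω - z)) P :=
    fun t ht => integrable_finsetSum _ fun i _ => (hround t ht i).2.1
  have hI := integral_mono_ae (integrable_finsetSum _ hgI) (integrable_const B) hB
  rw [integral_finsetSum _ hgI, integral_const, probReal_univ, one_smul] at hI
  unfold pathRegret
  rw [integral_finsetSum _ fun t ht => integrable_finsetSum _ fun i _ => hi1 t ht i]
  calc ∑ t ∈ Finset.Icc (1 : ℤ) T, ∫ ω, ∑ i, (f t i (x t i ω) - f t i z) ∂P
      ≤ ∑ t ∈ Finset.Icc (1 : ℤ) T, (∫ ω, ∑ i, inner ℝ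
        (orfEstimator δ f (fun t i => u t i ω) (fun t i => x t i ω) t i) (x t i ω - z) ∂P +
          N * (2 * L * δ)) := by
        refine Finset.sum_le_sum fun t ht => ?_
        rw [integral_finsetSum _ fun i _ => hi1 t ht i,
          integral_finsetSum _ fun i _ => (hround t ht i).2.1]
        have : (N : ℝ) * (2 * L * δ) = ∑ _i : Fin N, 2 * L * δ := by simp
        rw [this, ← Finset.sum_add_distrib]
        refine Finset.sum_le_sum fun i _ => ?_
        rw [integral_sub (hround t ht i).1 (integrable_const _), integral_const, probReal_univ,
          one_smul]
        linarith [(hround t ht i).2.2]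
    _ ≤ B + 2 * L * δ * (N * T) := by
        rw [Finset.sum_add_distrib, sum_Icc_one_int (fun _ => (N : ℝ) * (2 * L * δ))]
        simp only [Finset.sum_const, Finset.card_range, nsmul_eq_mul]
        linarith

/-- The trivial bound: the regret of each agent in each round is at most the Lipschitz constant
times the diameter. -/
theorem pathRegret_le {N d : ℕ} {X : Set (Vec d)} {r : ℝ} (hXr : X ⊆ Metric.closedBall 0 r)
    {δ L : ℝ} (hL0 : 0 ≤ L) {f : ℤ → Fin N → Vec d → ℝ} {T : ℕ}
    (hL : ∀ t : ℤ, -1 ≤ t → t ≤ T → ∀ i, ∀ y ∈ enlargement X δ, ∀ z ∈ enlargement X δ,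
      |f t i y - f t i z| ≤ L * ‖y - z‖) {x : ℤ → Fin N → Vec d}
    (hx : ∀ t : ℤ, -1 ≤ t → t ≤ T → ∀ i, x t i ∈ X) {z : Vec d} (hz : z ∈ X) :
    pathRegret f T z x ≤ N * (2 * r * L) * T := by
  have h : ∀ t ∈ Finset.Icc (1 : ℤ) T, ∑ i, (f t i (x t i) - f t i z) ≤ N * (2 * r * L) := by
    intro t ht
    obtain ⟨h1, h2⟩ := Finset.mem_Icc.1 ht
    have : (N : ℝ) * (2 * r * L) = ∑ _i : Fin N, 2 * r * L := by simp
    rw [this]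
    refine Finset.sum_le_sum fun i _ => ?_
    have hm := hx t (by omega) h2 i
    have h3 := hL t (by omega) h2 i _ (mem_enlargement_of_mem δ hm) _ (mem_enlargement_of_mem δ hz)
    have h4 : ‖x t i - z‖ ≤ 2 * r := by
      have h5 : ‖x t i‖ ≤ r := by simpa using hXr hm
      have h6 : ‖z‖ ≤ r := by simpa using hXr hz
      linarith [norm_sub_le (x t i) z]
    linarith [mul_le_mul_of_nonneg_left h4 hL0, le_abs_self (f t i (x t i) - f t i z)]
  refine (Finset.sum_le_sum h).trans (le_of_eq ?_)
  simp
  ring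

/-! ### The choice of parameters -/

theorem two_le_alpha {N : ℕ} {ε : ℝ} (hN : 1 ≤ N) (hε₀ : 0 < ε) (hε₁ : ε < 1) :
    2 ≤ alpha N ε := by
  have hN' : (1 : ℝ) ≤ N := by exact_mod_cast hN
  have h4 : ε / (4 * (N : ℝ) ^ 2) ≤ 1 := by
    rw [div_le_one (by positivity)]
    nlinarith
  have h0 : 0 < ε / (4 * (N : ℝ) ^ 2) := by positivity
  have h1 : 0 ≤ 1 - mixRate N ε ^ 2 := by
    unfold mixRate
    nlinarith
  unfold alpha
  have : 0 ≤ 60 * (N : ℝ) ^ 2 / (1 - mixRate N ε ^ 2) := by positivity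
  linarith

theorem rpow_two_thirds_eq (T : ℕ) : (T : ℝ) ^ (2 / 3 : ℝ) = ((T : ℝ) ^ (1 / 3 : ℝ)) ^ 2 := by
  rw [← Real.rpow_natCast, ← Real.rpow_mul (Nat.cast_nonneg T)]
  norm_num

theorem rpow_one_third_pow_three (T : ℕ) : ((T : ℝ) ^ (1 / 3 : ℝ)) ^ 3 = T := by
  rw [← Real.rpow_natCast, ← Real.rpow_mul (Nat.cast_nonneg T)]
  norm_num

end DistORF

theorem theorem1 (N d : ℕ) (hN : 1 ≤ N) (hd : 1 ≤ d) (ε κ L₀ r_u M : ℝ)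
    (hε₀ : 0 < ε) (hε₁ : ε < 1) (hκ : 0 < κ) (hL₀ : 0 < L₀) (hr_u : 0 < r_u) :
    ∃ C : ℝ, ∀ (T : ℕ), 1 ≤ T →
      -- the network
      ∀ (G : SimpleGraph (Fin N)) (A : Matrix (Fin N) (Fin N) ℝ),
      DistORF.IsWeightMatrix G A ε κ →
      -- the constraint set
      ∀ (X : Set (DistORF.Vec d)), IsClosed X → Convex ℝ X →
      (∃ r_l : ℝ, 0 < r_l ∧ Metric.closedBall 0 r_l ⊆ X) → X ⊆ Metric.closedBall 0 r_u →
      -- the losses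
      ∀ (f : ℤ → Fin N → DistORF.Vec d → ℝ),
      (∀ t : ℤ, -1 ≤ t → t ≤ T → ∀ i,
        ConvexOn ℝ (DistORF.enlargement X (DistORF.radius T)) (f t i)) →
      (∀ t : ℤ, -1 ≤ t → t ≤ T → ∀ i,
        ∀ y ∈ DistORF.enlargement X (DistORF.radius T),
        ∀ z ∈ DistORF.enlargement X (DistORF.radius T),
          |f t i y - f t i z| ≤ L₀ * ‖y - z‖) →
      (∀ i, DistORF.theta X (DistORF.radius T) f 0 i ≤ M) →
      -- the initial points
      ∀ (xprev xinit : Fin N → DistORF.Vec d), (∀ i, xprev i ∈ X) → (∀ i, xinit i ∈ X) →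
      -- the random directions
      ∀ (Ω : Type*) [MeasurableSpace Ω] (P : MeasureTheory.Measure Ω)
        [MeasureTheory.IsProbabilityMeasure P] (u : ℤ → Fin N → Ω → DistORF.Vec d),
      (∀ t : ℤ, -1 ≤ t → t ≤ T → ∀ i,
        ProbabilityTheory.HasLaw (u t i) (DistORF.uniformSphere d) P) →
      ProbabilityTheory.iIndepFun
        (fun p : Set.Icc (-1 : ℤ) (T : ℤ) × Fin N => u (p.1 : ℤ) p.2) P →
      -- the iterates
      ∀ (x : ℤ → Fin N → Ω → DistORF.Vec d),
      (∀ ω, DistORF.IsRun X A (DistORF.stepSize N d ε L₀ T) (DistORF.radius T) f T xprev xinit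
        (fun t i => u t i ω) (fun t i => x t i ω)) →
      -- the comparator
      ∀ xstar ∈ X,
      IsMinOn (fun z => ∑ t ∈ Finset.Icc (1 : ℤ) T, ∑ i, f t i z) X xstar →
      MeasureTheory.Integrable
        (fun ω => DistORF.pathRegret f T xstar (fun t i => x t i ω)) P ∧
      ∫ ω, DistORF.pathRegret f T xstar (fun t i => x t i ω) ∂P ≤
        C * max ((T : ℝ) ^ (2 / 3 : ℝ)) (DistORF.Theta X (DistORF.radius T) f T ^ 2) := by
  set α := DistORF.alpha N ε
  have hα2 : 2 ≤ α := DistORF.two_le_alpha hN hε₀ hε₁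
  have hd0 : (0 : ℝ) < d := by exact_mod_cast hd
  set c : ℝ := √(3 * α) * d * L₀ with hc
  have hsq : √(3 * α) ^ 2 = 3 * α := Real.sq_sqrt (by linarith)
  have hs0 : 0 < √(3 * α) := Real.sqrt_pos.2 (by linarith)
  have hc0 : 0 < c := by positivity
  set D : ℝ := N * (4 * r_u ^ 2)
  refine ⟨D * c / 2 + (1 + κ) * (3 * d ^ 2 / (4 * c)) *
    (1 + N * (16 * L₀ ^ 2) + L₀ ^ 2 * (D * (1 + 2 / κ))) + 4 * L₀ * N +
      N * (2 * r_u * L₀) * (1 + 1 / κ), ?_⟩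
  intro T hT G A hA X hXc hX _ hXr f hf hL _ xprev xinit hprev hinit Ω _ P _ u hu hind x hx xstar
    hxs _
  set τ : ℝ := (T : ℝ) ^ (1 / 3 : ℝ) with hτ
  have hT1 : (1 : ℝ) ≤ T := by exact_mod_cast hT
  have hτ1 : 1 ≤ τ := Real.one_le_rpow hT1 (by norm_num)
  have hτ0 : 0 < τ := by linarith
  have hτ3 : (T : ℝ) = τ ^ 3 := (DistORF.rpow_one_third_pow_three T).symm
  have hη : DistORF.stepSize N d ε L₀ T = 1 / (c * τ ^ 2) := by
    rw [DistORF.stepSize, DistORF.rpow_two_thirds_eq]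
  have hδ : DistORF.radius T = 2 / τ := rfl
  rw [hδ] at hf hL ⊢
  simp only [hη, hδ] at hx
  rw [DistORF.rpow_two_thirds_eq, ← hτ]
  set Θ := DistORF.Theta X (2 / τ) f T
  have hm1 : τ ^ 2 ≤ max (τ ^ 2) (Θ ^ 2) := le_max_left _ _
  have hm2 : Θ ^ 2 ≤ max (τ ^ 2) (Θ ^ 2) := le_max_right _ _
  set m := max (τ ^ 2) (Θ ^ 2)
  have hτm : τ ≤ m := by nlinarith
  have h1m : 1 ≤ m := hτ1.trans hτm
  have hδ0 : 0 < 2 / τ := by positivity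
  obtain ⟨hint, hreg⟩ := DistORF.integrable_pathRegret_and_integral_le hd hXc hX hXr hδ0 hL₀.le
    hf hL hprev hinit hu hind hx hxs
  refine ⟨hint, ?_⟩
  rcases lt_or_ge (τ ^ 2) (1 + 1 / κ) with hsmall | hlarge
  · have hle : ∫ ω, DistORF.pathRegret f T xstar (fun t i => x t i ω) ∂P ≤
        N * (2 * r_u * L₀) * T := by
      have := integral_mono hint (integrable_const (μ := P) (N * (2 * r_u * L₀) * T : ℝ))
        fun ω => DistORF.pathRegret_le hXr hL₀.le hL
          (fun t h1 h2 i => (hx ω).mem hprev hinit h1 (by omega) i) hxs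
      simpa using this
    have hT' : (T : ℝ) ≤ (1 + 1 / κ) * m := by
      rw [hτ3, pow_succ]
      gcongr
    calc _ ≤ N * (2 * r_u * L₀) * T := hle
      _ ≤ N * (2 * r_u * L₀) * ((1 + 1 / κ) * m) := by gcongr
      _ = N * (2 * r_u * L₀) * (1 + 1 / κ) * m := by ring
      _ ≤ _ := mul_le_mul_of_nonneg_right (le_add_of_nonneg_left (by positivity)) (by positivity)
  · have hbound := hreg _ (by
      have hae : ∀ᵐ ω ∂P, ∀ t : ℤ, -1 ≤ t → t ≤ T → ∀ i, ‖u t i ω‖ = 1 := by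
        rw [ae_all_iff]
        intro t
        by_cases h : -1 ≤ t ∧ t ≤ T
        · filter_upwards [ae_all_iff.2 fun i =>
            DistORF.ae_norm_eq_one_of_hasLaw (hu t h.1 h.2 i)] with ω hω _ _ i using hω i
        · exact Filter.Eventually.of_forall fun ω h1 h2 => absurd ⟨h1, h2⟩ h
      filter_upwards [hae] with ω hω
      refine (hx ω).sum_inner_orfEstimator_le hX hXr hε₀ hκ hA (by positivity) hδ0 hL₀.le hL hprev
        hinit hω ?_ hxs
      -- The coefficient of the feedback loop is `(1 + 1/κ) / (2 α τ²)`.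
      have e : 3 * (d : ℝ) ^ 2 / (2 / τ) ^ 2 * L₀ ^ 2 * (2 / κ) * (1 + κ) *
          (1 / (c * τ ^ 2)) ^ 2 = (1 + 1 / κ) / (2 * α * τ ^ 2) := by
        have hc2 : c ^ 2 = 3 * α * d ^ 2 * L₀ ^ 2 := by rw [hc, mul_pow, mul_pow, hsq]
        have hα0 : α ≠ 0 := by linarith
        rw [div_pow 1, mul_pow c, hc2]
        field_simp
        ring
      rw [e, div_le_div_iff₀ (by positivity) (by norm_num)]
      nlinarith)
    refine hbound.trans ?_
    rw [hτ3]
    calc _ = D * c / 2 * τ ^ 2 + (1 + κ) * (3 * d ^ 2 / (4 * c)) *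
          (Θ ^ 2 + N * (16 * L₀ ^ 2) * τ + L₀ ^ 2 * (D * (1 + 2 / κ)) * 1) +
            4 * L₀ * N * τ ^ 2 := by
          field_simp
          ring
      _ ≤ D * c / 2 * m + (1 + κ) * (3 * d ^ 2 / (4 * c)) *
          (m + N * (16 * L₀ ^ 2) * m + L₀ ^ 2 * (D * (1 + 2 / κ)) * m) +
            4 * L₀ * N * m := by gcongr
      _ = (D * c / 2 + (1 + κ) * (3 * d ^ 2 / (4 * c)) *
          (1 + N * (16 * L₀ ^ 2) + L₀ ^ 2 * (D * (1 + 2 / κ))) + 4 * L₀ * N) * m := by ring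
      _ ≤ _ := mul_le_mul_of_nonneg_right (le_add_of_nonneg_right (by positivity)) (by positivity)
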